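/- Let $(W,S)$ be a Coxeter system with $S$ finite and length function $\ell$, let $\Gamma$ be a totally ordered abelian group, and let $\varphi\colon W\to\Gamma$ be a weight function, i.e. $\varphi(ww')=\varphi(w)+\varphi(w')$ whenever $\ell(ww')=\ell(w)+\ell(w')$. Let $A=\mathbb Z[\Gamma]=\bigoplus_{\gamma\in\Gamma}\mathbb Z e^{\gamma}$. Let $\mathcal H$ be the Hecke algebra of $(W,S,\Gamma,\varphi)$: the unital $A$-algebra generated by elements $T_w$ ($w\in W$) with $T_1=1$, $T_wT_{w'}=T_{ww'}$ if $\ell(ww')=\ell(w)+\ell(w')$, and $(T_s-e^{\varphi(s)})(T_s+e^{-\varphi(s)})=0$ for $s\in S$. Let $h\mapsto\overline h$ be the ring endomorphism of $\mathcal H$ with $\overline{e^\gamma}=e^{-\gamma}$ and $\overline{T_w}=T_{w^{-1}}^{-1}$. For $w\in W$ let $C_w\in\mathcal H$ be the Kazhdan–Lusztig element, determined by $\overline{C_w}=C_w$ and $C_w-T_w\in\bigoplus_{v\in W}A_{<0}T_v$, where $A_{<0}=\bigoplus_{\gamma<0}\mathbb Z e^\gamma$. Let $\tau\colon\mathcal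 H\to A$ be the $A$-linear map with $\tau(T_1)=1$ and $\tau(T_w)=0$ for $w\ne1$, and let $h_{x,y,z}\in A$ be the structure constants, zero for all but finitely many $z$, given by $C_xC_y=\sum_{z\in W}h_{x,y,z}C_z$. Let $p$ be a prime and let $G$ be a finite $p$-group of automorphisms of $W$ such that $\sigma(S)=S$ and $\varphi\circ\sigma=\varphi$ for all $\sigma\in G$. Let $W^G$ be the subgroup of fixed points of $G$ in $W$, let $S_G\subseteq W^G$ be the set of the longest elements of the subgroups $\langle\omega\rangle$, where $\omega$ runs over the $G$-orbits in $S$ such that $\langle\omega\rangle$ is finite, and let $\varphi_G$ be the restriction of $\varphi$ to $W^G$. Denote by $\mathcal H_G$, $T^G_w$, $C^G_w$, $\tau_G$, $h^G_{x,y,z}$ the objects defined as above from $(W^G,S_G,\Gamma,\varphi_G)$, with the length function of $W^G$ relative to $S_G$. Then all these objects are well defined for both data: the elements $T_w$ (resp. $T^G_w$) form an $A$-basis of $\mathcal H$ (resp. $\mathcal H_G$), and the bar map, $\tau$, the Kazhdan–Lusztig elements and the structure constants exist and are unique. Moreover, for all $x,y,z\in W^G$, $$h_{x,y,z}\equiv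 h^G_{x,y,z}\mod pA\qquad\text{and}\qquad \tau(C_z)\equiv\tau_G(C^G_z)\mod pA .$$ -/

import Mathlib

open scoped AddMonoidAlgebra

/-! Hecke algebras and Kazhdan-Lusztig bases attached to a group `W`, a set `S` of elements of `W`
and a function `φ : W → Γ` with values in a totally ordered abelian group. They are used for
`(W, S)` a Coxeter system and `φ` a weight function. -/

namespace KL

noncomputable section

section Length

variable {W : Type*} [Group W]

/-- The length function of `(W, S)`: the least number of factors in a product of elements of `S`
that is equal to `w`. -/
def wordLength (S : Set W) (w : W) : ℕ :=
  sInf {n : ℕ | ∃ l : List W, (∀ s ∈ l, s ∈ S) ∧ l.prod = w ∧ l.length = n}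

/-- For a Coxeter system, `wordLength` is the usual length function. -/
theorem wordLength_range_simple {B : Type*} {M : CoxeterMatrix B} (cs : CoxeterSystem M W)
    (w : W) : wordLength (Set.range cs.simple) w = cs.length w := by
  apply le_antisymm
  · obtain ⟨l, hl, rfl⟩ := cs.exists_isReduced w
    apply Nat.sInf_le
    refine ⟨l.map cs.simple, ?_, rfl, ?_⟩
    · intro s hs
      obtain ⟨i, -, rfl⟩ := List.mem_map.1 hs
      exact ⟨i, rfl⟩
    · simpa using hl.eq.symm
  · apply le_csInf
    · obtain ⟨l, rfl⟩ := cs.wordProd_surjective w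
      refine ⟨_, l.map cs.simple, ?_, rfl, rfl⟩
      intro s hs
      obtain ⟨i, -, rfl⟩ := List.mem_map.1 hs
      exact ⟨i, rfl⟩
    · rintro n ⟨l, hl, rfl, rfl⟩
      obtain ⟨l', rfl⟩ : ∃ l' : List B, l'.map cs.simple = l := by
        have : l ∈ Set.range (List.map cs.simple) := by
          rw [Set.range_list_map]
          exact hl
        exact this
      simpa [CoxeterSystem.wordProd] using cs.length_wordProd_le l'

/-- Weight functions: `φ (w w') = φ w + φ w'` whenever `ℓ (w w') = ℓ w + ℓ w'`. -/
def IsWeightFunction {Γ : Type*} [Add Γ] (S : Set W) (φ : W → Γ) : Prop :=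
  ∀ w w' : W, wordLength S (w * w') = wordLength S w + wordLength S w' →
    φ (w * w') = φ w + φ w'

/-- `w` is a longest element of the standard parabolic subgroup generated by `I ⊆ S`. -/
def IsLongest (S I : Set W) (w : W) : Prop :=
  w ∈ Subgroup.closure I ∧ ∀ v ∈ Subgroup.closure I, wordLength S v ≤ wordLength S w

/-- The set `S_G` of the longest elements `s_ω` of the subgroups `W_ω = ⟨ω⟩`, where `ω` runs over
the `G`-orbits in `S` such that `W_ω` is finite, as a subset of the group `W ^ G` of fixed
points. -/
def fixedSimple (S : Set W) (G : Subgroup (MulAut W)) : Set (FixedPoints.subgroup G W) :=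
  {x | ∃ s ∈ S, (Subgroup.closure (MulAction.orbit G s) : Set W).Finite ∧
    IsLongest S (MulAction.orbit G s) (x : W)}

/-- The restriction `φ_G` of `φ` to `W ^ G`. -/
def fixedWeight {Γ : Type*} (φ : W → Γ) (G : Subgroup (MulAut W)) :
    FixedPoints.subgroup G W → Γ :=
  fun w => φ (w : W)

end Length

section Hecke

variable {W : Type*} [Group W] {Γ : Type*} [AddCommGroup Γ]

/-- The element `e ^ γ` of the group algebra `A = ℤ[Γ]`. -/
def expo (γ : Γ) : ℤ[Γ] := AddMonoidAlgebra.single γ 1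

/-- The defining relations of the Hecke algebra between the generators `T_w`, `w ∈ W`. -/
inductive HeckeRel (S : Set W) (φ : W → Γ) : FreeAlgebra ℤ[Γ] W → FreeAlgebra ℤ[Γ] W → Prop
  | one : HeckeRel S φ (FreeAlgebra.ι ℤ[Γ] 1) 1
  | mul (w w' : W) (h : wordLength S (w * w') = wordLength S w + wordLength S w') :
      HeckeRel S φ (FreeAlgebra.ι ℤ[Γ] w * FreeAlgebra.ι ℤ[Γ] w') (FreeAlgebra.ι ℤ[Γ] (w * w'))
  | quadratic (s : W) (hs : s ∈ S) :
      HeckeRel S φ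
        ((FreeAlgebra.ι ℤ[Γ] s - algebraMap ℤ[Γ] _ (expo (φ s))) *
          (FreeAlgebra.ι ℤ[Γ] s + algebraMap ℤ[Γ] _ (expo (-φ s)))) 0

/-- The Hecke algebra of `(W, S, Γ, φ)`, an algebra over `A = ℤ[Γ]`. -/
def Hecke (S : Set W) (φ : W → Γ) : Type _ := RingQuot (HeckeRel S φ)

instance (S : Set W) (φ : W → Γ) : Ring (Hecke S φ) :=
  inferInstanceAs (Ring (RingQuot (HeckeRel S φ)))

instance (S : Set W) (φ : W → Γ) : Algebra ℤ[Γ] (Hecke S φ) :=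
  inferInstanceAs (Algebra ℤ[Γ] (RingQuot (HeckeRel S φ)))

/-- The canonical map from the free algebra to the Hecke algebra. -/
def mk (S : Set W) (φ : W → Γ) : FreeAlgebra ℤ[Γ] W →ₐ[ℤ[Γ]] Hecke S φ :=
  RingQuot.mkAlgHom ℤ[Γ] (HeckeRel S φ)

/-- The standard basis element `T_w`. -/
def T (S : Set W) (φ : W → Γ) (w : W) : Hecke S φ :=
  mk S φ (FreeAlgebra.ι ℤ[Γ] w)

/-- `β` is the bar involution: `β (e ^ γ) = e ^ (-γ)`, and `β (T_w)` is the inverse of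
`T_{w⁻¹}`. -/
def IsBar (S : Set W) (φ : W → Γ) (β : Hecke S φ →+* Hecke S φ) : Prop :=
  (∀ γ : Γ, β (algebraMap ℤ[Γ] _ (expo γ)) = algebraMap ℤ[Γ] _ (expo (-γ))) ∧
    ∀ w : W, β (T S φ w) * T S φ w⁻¹ = 1 ∧ T S φ w⁻¹ * β (T S φ w) = 1

/-- The bar involution of the Hecke algebra. -/
def bar (S : Set W) (φ : W → Γ) : Hecke S φ →+* Hecke S φ :=
  @Classical.epsilon _ ⟨RingHom.id _⟩ (IsBar S φ)

/-- The subgroup `⊕_w A_{<0} T_w`, where `A_{<0} = ⊕_{γ < 0} ℤ e ^ γ`. -/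
def negPart [LinearOrder Γ] (S : Set W) (φ : W → Γ) : AddSubgroup (Hecke S φ) :=
  AddSubgroup.closure {h | ∃ γ : Γ, γ < 0 ∧ ∃ w : W, h = expo γ • T S φ w}

/-- The defining property of the Kazhdan-Lusztig element `C_w`. -/
def IsKLElement [LinearOrder Γ] (S : Set W) (φ : W → Γ) (w : W) (c : Hecke S φ) : Prop :=
  bar S φ c = c ∧ c - T S φ w ∈ negPart S φ

/-- The Kazhdan-Lusztig basis `(C_w)`. -/
def C [LinearOrder Γ] (S : Set W) (φ : W → Γ) (w : W) : Hecke S φ :=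
  @Classical.epsilon _ ⟨0⟩ (IsKLElement S φ w)

open Classical in
/-- `t` is the `A`-linear form with `t (T_1) = 1` and `t (T_w) = 0` for `w ≠ 1`. -/
def IsTau (S : Set W) (φ : W → Γ) (t : Hecke S φ →ₗ[ℤ[Γ]] ℤ[Γ]) : Prop :=
  ∀ w : W, t (T S φ w) = if w = 1 then 1 else 0

/-- The linear form `τ`. -/
def tau (S : Set W) (φ : W → Γ) : Hecke S φ →ₗ[ℤ[Γ]] ℤ[Γ] :=
  @Classical.epsilon _ ⟨0⟩ (IsTau S φ)

/-- `f` is the (finitely supported) family of coordinates of `C_x C_y` in the Kazhdan-Lusztig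
basis. -/
def IsStructureFamily [LinearOrder Γ] (S : Set W) (φ : W → Γ) (x y : W) (f : W →₀ ℤ[Γ]) : Prop :=
  C S φ x * C S φ y = f.sum fun z a => a • C S φ z

/-- The structure constants `h_{x,y,z}`, with `C_x C_y = ∑_z h_{x,y,z} C_z`. -/
def structureConst [LinearOrder Γ] (S : Set W) (φ : W → Γ) (x y z : W) : ℤ[Γ] :=
  @Classical.epsilon _ ⟨0⟩ (IsStructureFamily S φ x y) z

/-- All the objects above are well defined: `(T_w)` is an `A`-basis of the Hecke algebra, and the
bar involution, the linear form `τ`, the elements `C_w` and the constants `h_{x,y,z}` exist and are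
determined uniquely by their defining properties. -/
structure WellDefined [LinearOrder Γ] (S : Set W) (φ : W → Γ) : Prop where
  linearIndependent_T : LinearIndependent ℤ[Γ] (T S φ)
  span_T : Submodule.span ℤ[Γ] (Set.range (T S φ)) = ⊤
  bar : ∃! β, IsBar S φ β
  tau : ∃! t, IsTau S φ t
  C : ∀ w, ∃! c, IsKLElement S φ w c
  structureConst : ∀ x y, ∃! f, IsStructureFamily S φ x y f

end Hecke

end

end KL

/-! Modulo `p`, passing to `G`-fixed points behaves like a Brauer homomorphism. A `G`-invariant
element of the Hecke algebra has coefficients constant on `G`-orbits of basis elements. Non-trivial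
orbits have cardinality divisible by `p`, so an additive `G`-invariant map into a group killed by
`p` sees only the fixed basis elements (`eq_of_eq_on_fixed_basis`). Let `proj` send `T_w` to `T^G_w`
for fixed `w` and kill the other `T_w`. On invariants it is multiplicative modulo `p` (`proj_mul`)
and commutes with bar modulo `p` (`proj_bar`).

The crux is the square of `T_x` for `x = s_ω`. It is supported on `W_ω`, whose only fixed points are
`1` and `x`, so its projection is `1 + a T^G_x`; the constant term is `τ(T_x T_x) = 1`. The index
character `T_w ↦ e^φ(w)` then gives `e^(2φ(x)) ≡ 1 + a e^φ(x)`, which forces `a ≡ e^φ(x) -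
e^(-φ(x))`: the quadratic relation of the fixed-point algebra (`proj_T_mul_self`).

The difference between the projection of `C_z` and `C^G_z` has coefficients in `A_{<0}` and is
bar-invariant modulo `p`. Since bar is unitriangular for the length filtration, such an element is
divisible by `p` (`exists_nsmul_of_bar_sub`). This gives the congruence for `τ` and, on expanding
products in the Kazhdan–Lusztig bases, the one for structure constants.

Well-definedness is proved for both data at once, from an axiom system by half-spaces (`HalfSystem`)
that yields the exchange condition. A sign cocycle provides half-spaces for a Coxeter system; the
ambient length function provides them for the fixed-point group. -/

namespace KL

/-! ### Length, exchange and folding deduced from half-spaces. -/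

section WordLength

variable {W : Type*} [Group W] {S : Set W} {P : W → W → Prop}

/-- The family of subsets `{w | P s w}`, `s ∈ S`, consists of "half-spaces" for the generating
set of involutions `S`. Such a family exists if and only if `(W, S)` is a Coxeter system. -/
structure HalfSystem (S : Set W) (P : W → W → Prop) : Prop where
  mul_self : ∀ s ∈ S, s * s = 1
  closure : Subgroup.closure S = ⊤
  one : ∀ s ∈ S, P s 1
  not_mul : ∀ s ∈ S, ∀ w, P s w → ¬ P s (s * w)
  comm : ∀ s ∈ S, ∀ t ∈ S, ∀ w, P s w → ¬ P s (w * t) → s * w = w * t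

theorem wordLength_prod_le {l : List W} (hl : ∀ s ∈ l, s ∈ S) :
    wordLength S l.prod ≤ l.length :=
  Nat.sInf_le ⟨l, hl, rfl, rfl⟩

theorem wordLength_one : wordLength S (1 : W) = 0 := by
  simpa using wordLength_prod_le (S := S) (l := []) (by simp)

theorem wordLength_le_one {s : W} (hs : s ∈ S) : wordLength S s ≤ 1 := by
  simpa using wordLength_prod_le (S := S) (l := [s]) (by simpa using hs)

namespace HalfSystem

theorem inv_eq (h : HalfSystem S P) {s : W} (hs : s ∈ S) : s⁻¹ = s :=
  inv_eq_of_mul_eq_one_right (h.mul_self s hs)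

theorem cancel (h : HalfSystem S P) {s : W} (hs : s ∈ S) (w : W) : s * (s * w) = w := by
  rw [← mul_assoc, h.mul_self s hs, one_mul]

theorem cancel_right (h : HalfSystem S P) {s : W} (hs : s ∈ S) (w : W) : w * s * s = w := by
  rw [mul_assoc, h.mul_self s hs, mul_one]

theorem exists_word (h : HalfSystem S P) (w : W) :
    ∃ l : List W, (∀ s ∈ l, s ∈ S) ∧ l.prod = w ∧ l.length = wordLength S w := by
  have key : {n : ℕ | ∃ l : List W, (∀ s ∈ l, s ∈ S) ∧ l.prod = w ∧ l.length = n}.Nonempty := by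
    have hw : w ∈ Subgroup.closure S := h.closure ▸ Subgroup.mem_top w
    rw [← Subgroup.mem_toSubmonoid, Subgroup.closure_toSubmonoid] at hw
    obtain ⟨l, hl, hp⟩ := Submonoid.exists_list_of_mem_closure hw
    refine ⟨l.length, l, fun s hs => ?_, hp, rfl⟩
    rcases hl s hs with h1 | h1
    · exact h1
    · rw [← inv_inv s, h.inv_eq h1]
      exact h1
  exact Nat.sInf_mem key

theorem wordLength_mul_le (h : HalfSystem S P) (x y : W) :
    wordLength S (x * y) ≤ wordLength S x + wordLength S y := by
  obtain ⟨l, hl, rfl, hx⟩ := h.exists_word x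
  obtain ⟨m, hm, rfl, hy⟩ := h.exists_word y
  rw [← hx, ← hy, ← List.prod_append, ← List.length_append]
  apply wordLength_prod_le
  intro s hs
  rcases List.mem_append.1 hs with h1 | h1
  exacts [hl s h1, hm s h1]

theorem wordLength_inv_le (h : HalfSystem S P) (x : W) :
    wordLength S x⁻¹ ≤ wordLength S x := by
  obtain ⟨l, hl, rfl, hx⟩ := h.exists_word x
  rw [← hx, List.prod_inv_reverse, ← List.length_map (as := l) (fun x => x⁻¹),
    ← List.length_reverse]
  apply wordLength_prod_le
  intro s hs
  simp only [List.mem_reverse, List.mem_map] at hs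
  obtain ⟨t, ht, rfl⟩ := hs
  rw [h.inv_eq (hl t ht)]
  exact hl t ht

theorem wordLength_inv (h : HalfSystem S P) (x : W) : wordLength S x⁻¹ = wordLength S x :=
  le_antisymm (h.wordLength_inv_le x) (by simpa using h.wordLength_inv_le x⁻¹)

theorem eq_one_of_wordLength (h : HalfSystem S P) {x : W} (hx : wordLength S x = 0) : x = 1 := by
  obtain ⟨l, -, rfl, hl⟩ := h.exists_word x
  rw [hx, List.length_eq_zero_iff] at hl
  simp [hl]

/-- Follow the gallery from `x` to `x * l.prod`. It leaves the half-space of `s` at some letter; at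
the first such letter, `comm` trades `s` on the left for that letter on the right, where it cancels.
-/
theorem exchange_aux (h : HalfSystem S P) {s : W} (hs : s ∈ S) (l : List W) :
    ∀ x : W, (∀ t ∈ l, t ∈ S) → P s x → ¬ P s (x * l.prod) →
      ∃ l' : List W, l'.Sublist l ∧ l'.length + 1 = l.length ∧ s * (x * l.prod) = x * l'.prod := by
  induction l with
  | nil => intro x _ h1 h2; simp [h1] at h2
  | cons t l ih =>
    intro x hl h1 h2
    by_cases h3 : P s (x * t)
    · obtain ⟨l', h4, h5, h6⟩ := ih (x * t) (fun u hu => hl u (by simp [hu])) h3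
        (by simpa [mul_assoc] using h2)
      refine ⟨t :: l', by simpa using h4, by simpa using h5, ?_⟩
      simpa [mul_assoc] using h6
    · refine ⟨l, by simp, by simp, ?_⟩
      have ht := hl t (by simp)
      have := h.comm s hs t ht x h1 h3
      rw [List.prod_cons, ← mul_assoc, this, mul_assoc, h.cancel ht]

theorem wordLength_lt_of_not (h : HalfSystem S P) {s : W} (hs : s ∈ S) {w : W} (hw : ¬ P s w) :
    wordLength S (s * w) < wordLength S w := by
  obtain ⟨l, hl, rfl, hx⟩ := h.exists_word w
  obtain ⟨l', h1, h2, h3⟩ := h.exchange_aux hs l 1 hl (h.one s hs) (by simpa using hw)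
  rw [one_mul, one_mul] at h3
  rw [h3, ← hx, ← h2, Nat.lt_succ_iff]
  exact wordLength_prod_le fun t ht => hl t (h1.subset ht)

/-- The abstract half-spaces are thus forced to be the sets of left ascents; afterwards only lengths
matter. -/
theorem iff_lt (h : HalfSystem S P) {s : W} (hs : s ∈ S) {w : W} :
    P s w ↔ wordLength S w < wordLength S (s * w) := by
  constructor
  · intro hw
    simpa [h.cancel hs] using h.wordLength_lt_of_not hs (h.not_mul s hs w hw)
  · intro hw
    by_contra h1
    exact lt_asymm hw (h.wordLength_lt_of_not hs h1)

theorem wordLength_simple_mul (h : HalfSystem S P) {s : W} (hs : s ∈ S) (w : W) :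
    wordLength S (s * w) = wordLength S w + 1 ∨ wordLength S (s * w) + 1 = wordLength S w := by
  have h1 := h.wordLength_mul_le s w
  have h2 := h.wordLength_mul_le s (s * w)
  rw [h.cancel hs] at h2
  have h3 := wordLength_le_one hs
  by_cases h4 : P s w
  · have := (h.iff_lt hs).1 h4
    lia
  · have := h.wordLength_lt_of_not hs h4
    lia

theorem wordLength_mul_simple (h : HalfSystem S P) {s : W} (hs : s ∈ S) (w : W) :
    wordLength S (w * s) = wordLength S w + 1 ∨ wordLength S (w * s) + 1 = wordLength S w := by
  rw [← h.wordLength_inv (w * s), ← h.wordLength_inv w, mul_inv_rev, h.inv_eq hs]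
  exact h.wordLength_simple_mul hs _

theorem wordLength_simple (h : HalfSystem S P) {s : W} (hs : s ∈ S) : wordLength S s = 1 := by
  have := h.wordLength_simple_mul hs 1
  rw [mul_one, wordLength_one] at this
  lia

theorem exchange (h : HalfSystem S P) {s : W} (hs : s ∈ S) {x : W} {l : List W}
    (hl : ∀ t ∈ l, t ∈ S) (h1 : wordLength S x < wordLength S (s * x))
    (h2 : wordLength S (s * (x * l.prod)) < wordLength S (x * l.prod)) :
    ∃ l' : List W, l'.Sublist l ∧ l'.length + 1 = l.length ∧ s * (x * l.prod) = x * l'.prod :=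
  h.exchange_aux hs l x hl ((h.iff_lt hs).2 h1) fun h3 => lt_asymm ((h.iff_lt hs).1 h3) h2

theorem exchange_mul (h : HalfSystem S P) {s : W} (hs : s ∈ S) {x y : W}
    (h1 : wordLength S x < wordLength S (s * x))
    (h2 : wordLength S (s * (x * y)) < wordLength S (x * y)) :
    ∃ y', wordLength S y' < wordLength S y ∧ s * (x * y) = x * y' := by
  obtain ⟨l, hl, rfl, hx⟩ := h.exists_word y
  obtain ⟨l', h3, h4, h5⟩ := h.exchange hs hl h1 h2
  refine ⟨_, ?_, h5⟩
  have := wordLength_prod_le (S := S) fun t ht => hl t (h3.subset ht)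
  lia

theorem fold (h : HalfSystem S P) {s t : W} (hs : s ∈ S) (ht : t ∈ S) {w : W}
    (h1 : wordLength S w < wordLength S (s * w))
    (h2 : wordLength S (s * (w * t)) < wordLength S (w * t)) : s * w = w * t :=
  h.comm s hs t ht w ((h.iff_lt hs).2 h1) fun h3 => lt_asymm ((h.iff_lt hs).1 h3) h2

/-! ### Standard parabolic subgroups and their longest elements. -/

section Parabolic

variable {I : Set W}

theorem exists_parabolic_word (h : HalfSystem S P) (hI : I ⊆ S) {c : W}
    (hc : c ∈ Subgroup.closure I) :
    ∃ l : List W, (∀ s ∈ l, s ∈ I) ∧ l.prod = c ∧ l.length = wordLength S c := by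
  have step : ∀ s ∈ I, ∀ c, (∃ l : List W, (∀ s ∈ l, s ∈ I) ∧ l.prod = c ∧
      l.length = wordLength S c) → ∃ l : List W, (∀ s ∈ l, s ∈ I) ∧ l.prod = s * c ∧
      l.length = wordLength S (s * c) := by
    rintro s hs c ⟨l, hl, rfl, hx⟩
    rcases h.wordLength_simple_mul (hI hs) l.prod with h1 | h1
    · refine ⟨s :: l, ?_, by simp, by simp [h1, hx]⟩
      intro t ht
      rcases List.mem_cons.1 ht with rfl | ht
      exacts [hs, hl t ht]
    · obtain ⟨l', h3, h4, h5⟩ := h.exchange (hI hs) (x := 1) (fun t ht => hI (hl t ht))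
        (by rw [mul_one, wordLength_one, h.wordLength_simple (hI hs)]; exact one_pos)
        (by simp only [one_mul]; lia)
      rw [one_mul, one_mul] at h5
      exact ⟨l', fun t ht => hl t (h3.subset ht), h5.symm, by lia⟩
  induction hc using Subgroup.closure_induction_left with
  | one => exact ⟨[], by simp, by simp, by simp [wordLength_one]⟩
  | mul_left s hs c _ ih => exact step s hs c ih
  | inv_mul_cancel s hs c _ ih =>
    rw [h.inv_eq (hI hs)]
    exact step s hs c ih

theorem parabolic_induction (h : HalfSystem S P) (hI : I ⊆ S) {p : W → Prop} (one : p 1)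
    (mul : ∀ s ∈ I, ∀ c ∈ Subgroup.closure I, wordLength S (s * c) = wordLength S c + 1 →
      p c → p (s * c)) {c : W} (hc : c ∈ Subgroup.closure I) : p c := by
  obtain ⟨l, hl, rfl, hx⟩ := h.exists_parabolic_word hI hc
  clear hc
  induction l with
  | nil => exact one
  | cons s l ih =>
    have hl' : ∀ t ∈ l, t ∈ I := fun t ht => hl t (by simp [ht])
    have hs : s ∈ I := hl s (by simp)
    have h1 := wordLength_prod_le (S := S) fun t ht => hI (hl' t ht)
    have h2 := h.wordLength_simple_mul (hI hs) l.prod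
    rw [List.prod_cons, List.length_cons] at hx
    rw [List.prod_cons]
    exact mul s hs _ (Subgroup.list_prod_mem _ fun t ht => Subgroup.subset_closure (hl' t ht))
      (by lia) (ih hl' (by lia))

theorem induction (h : HalfSystem S P) {p : W → Prop} (one : p 1)
    (mul : ∀ s ∈ S, ∀ c, wordLength S (s * c) = wordLength S c + 1 → p c → p (s * c)) (w : W) :
    p w :=
  h.parabolic_induction subset_rfl one (fun s hs c _ => mul s hs c)
    (h.closure ▸ Subgroup.mem_top w)

theorem induction_right (h : HalfSystem S P) {p : W → Prop} (one : p 1)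
    (mul : ∀ s ∈ S, ∀ c, wordLength S (c * s) = wordLength S c + 1 → p c → p (c * s)) (w : W) :
    p w := by
  rw [← inv_inv w]
  refine h.induction (p := fun w => p w⁻¹) (by simpa using one) (fun s hs c h1 h2 => ?_) w⁻¹
  rw [mul_inv_rev, h.inv_eq hs]
  refine mul s hs _ ?_ h2
  rw [← h.wordLength_inv, mul_inv_rev, inv_inv, h.inv_eq hs, h1, h.wordLength_inv]

theorem exists_descent (h : HalfSystem S P) (hI : I ⊆ S) {c : W}
    (hc : c ∈ Subgroup.closure I) (h1 : c ≠ 1) : ∃ s ∈ I, wordLength S (s * c) < wordLength S c := by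
  obtain h2 | h2 : c = 1 ∨ ∃ s ∈ I, wordLength S (s * c) < wordLength S c := by
    refine h.parabolic_induction hI
      (p := fun c => c = 1 ∨ ∃ s ∈ I, wordLength S (s * c) < wordLength S c)
      (Or.inl rfl) (fun s hs c _ hl _ => Or.inr ⟨s, hs, ?_⟩) hc
    rw [h.cancel (hI hs)]
    lia
  · exact absurd h2 h1
  · exact h2

/-- Grow `c` one letter at a time. Since `s` lengthens `c` but shortens `w = c * d`, the exchanged
letter must be deleted from `d`. -/
theorem exists_factor (h : HalfSystem S P) (hI : I ⊆ S) {w : W}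
    (hw : ∀ s ∈ I, wordLength S (s * w) < wordLength S w) {c : W}
    (hc : c ∈ Subgroup.closure I) :
    ∃ d, w = c * d ∧ wordLength S w = wordLength S c + wordLength S d := by
  refine h.parabolic_induction hI
    (p := fun c => ∃ d, w = c * d ∧ wordLength S w = wordLength S c + wordLength S d)
    ⟨w, by simp, by simp [wordLength_one]⟩ ?_ hc
  rintro s hs c - hl ⟨d, h1, h2⟩
  have h3 := hw s hs
  rw [h1] at h3
  obtain ⟨y, hy, h4⟩ := h.exchange_mul (hI hs) (by lia) h3
  have h5 : w = s * c * y := by rw [mul_assoc, ← h4, ← h1, h.cancel (hI hs)]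
  refine ⟨y, h5, le_antisymm ?_ (by lia)⟩
  conv_lhs => rw [h5]
  exact h.wordLength_mul_le _ _

/-- Lengths add for the shortest element `c₀ * w` of the coset, since an exchange deleting a letter
from it would contradict minimality. If `c₀ ≠ 1`, a left descent of `c₀⁻¹` would then be a descent
of `w`. -/
theorem wordLength_mul_of_ascents (h : HalfSystem S P) (hI : I ⊆ S) {w : W}
    (hw : ∀ s ∈ I, wordLength S w < wordLength S (s * w)) {c : W}
    (hc : c ∈ Subgroup.closure I) :
    wordLength S (c * w) = wordLength S c + wordLength S w := by
  obtain ⟨c₀, hc₀, hmin⟩ : ∃ c₀ ∈ Subgroup.closure I, ∀ c ∈ Subgroup.closure I,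
      wordLength S (c₀ * w) ≤ wordLength S (c * w) := by
    have := Function.argminOn_mem (fun c => wordLength S (c * w))
      (Subgroup.closure I : Set W) ⟨1, one_mem _⟩
    exact ⟨_, this, fun c hc => Function.argminOn_le (fun c => wordLength S (c * w)) _ hc⟩
  have key : ∀ c ∈ Subgroup.closure I,
      wordLength S (c * (c₀ * w)) = wordLength S c + wordLength S (c₀ * w) := by
    intro c hc
    refine h.parabolic_induction hI
      (p := fun c => wordLength S (c * (c₀ * w)) = wordLength S c + wordLength S (c₀ * w))
      (by simp [wordLength_one]) ?_ hc
    intro s hs c hc hl ih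
    rcases h.wordLength_simple_mul (hI hs) (c * (c₀ * w)) with h1 | h1
    · rw [mul_assoc, h1, ih, hl]; ring
    · obtain ⟨y, hy, h2⟩ := h.exchange_mul (hI hs) (x := c) (y := c₀ * w) (by lia) (by lia)
      have h3 := hmin (c⁻¹ * (s * (c * c₀))) (mul_mem (inv_mem hc)
        (mul_mem (Subgroup.subset_closure hs) (mul_mem hc hc₀)))
      have h4 : c⁻¹ * (s * (c * c₀)) * w = y := by
        rw [eq_comm, ← mul_left_cancel_iff (a := c), ← h2]; group
      rw [h4] at h3
      lia
  have h0 : c₀⁻¹ = 1 := by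
    by_contra h1
    obtain ⟨s, hs, h2⟩ := h.exists_descent hI (inv_mem hc₀) h1
    have h3 := key _ (inv_mem hc₀)
    have h4 := key _ (mul_mem (Subgroup.subset_closure hs) (inv_mem hc₀))
    have h5 := hw s hs
    rw [mul_assoc, inv_mul_cancel_left] at h4
    rw [inv_mul_cancel_left] at h3
    lia
  rw [inv_eq_one] at h0
  simpa [h0] using key c hc

/-- Every element of the parabolic subgroup is a reduced left factor of `w`, so it is a word in `I`
of length at most that of `w`. -/
theorem finite_closure_of_descents (h : HalfSystem S P) (hI : I ⊆ S) (hfin : I.Finite) {w : W}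
    (hw : ∀ s ∈ I, wordLength S (s * w) < wordLength S w) :
    (Subgroup.closure I : Set W).Finite := by
  have : Finite I := hfin
  refine ((List.finite_length_le I (wordLength S w)).image
    fun l => (l.map Subtype.val).prod).subset ?_
  intro c hc
  obtain ⟨l, hl, h1, h2⟩ := h.exists_parabolic_word hI hc
  obtain ⟨d, -, h3⟩ := h.exists_factor hI hw hc
  refine ⟨l.attach.map fun x => ⟨x.1, hl x.1 x.2⟩, by simp; lia, ?_⟩
  simp [h1, Function.comp_def]

theorem descent_of_isLongest (h : HalfSystem S P) (hI : I ⊆ S) {w : W} (hw : IsLongest S I w)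
    {s : W} (hs : s ∈ I) : wordLength S (s * w) < wordLength S w := by
  have := hw.2 _ (mul_mem (Subgroup.subset_closure hs) hw.1)
  have := h.wordLength_simple_mul (hI hs) w
  lia

/-- By `exists_factor`, the longest element is a reduced left factor of `w'`; maximality leaves no
room for the other factor. -/
theorem isLongest_unique (h : HalfSystem S P) (hI : I ⊆ S) {w w' : W} (hw : IsLongest S I w)
    (hw' : w' ∈ Subgroup.closure I)
    (hd : ∀ s ∈ I, wordLength S (s * w') < wordLength S w') : w' = w := by
  obtain ⟨d, h1, h2⟩ := h.exists_factor hI hd hw.1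
  have := hw.2 _ hw'
  rw [h1, h.eq_one_of_wordLength (x := d) (by lia), mul_one]

theorem isLongest_mul_self (h : HalfSystem S P) (hI : I ⊆ S) {w : W} (hw : IsLongest S I w) :
    w * w = 1 := by
  have h1 : IsLongest S I w⁻¹ :=
    ⟨inv_mem hw.1, fun v hv => by rw [h.wordLength_inv]; exact hw.2 v hv⟩
  have h2 := h.isLongest_unique hI hw h1.1 fun s hs => h.descent_of_isLongest hI h1 hs
  nth_rw 1 [← h2]
  simp

theorem exists_isLongest (hfin : (Subgroup.closure I : Set W).Finite) : ∃ w, IsLongest S I w := by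
  obtain ⟨w, h1, h2⟩ := Set.exists_max_image _ (wordLength S) hfin ⟨1, one_mem _⟩
  exact ⟨w, h1, h2⟩

end Parabolic

end HalfSystem

end WordLength

/-! ### Half-spaces of a Coxeter system from a sign cocycle. -/

section Coxeter

variable {B W : Type*} [Group W] {M : CoxeterMatrix B} (cs : CoxeterSystem M W)

open Classical in
/-- The action of a simple reflection on pairs made of a (potential) reflection and a sign. -/
noncomputable def signedConj (s : W) : Function.End (W × ZMod 2) :=
  fun x => (s * x.1 * s⁻¹, x.2 + if x.1 = s then 1 else 0)

theorem end_mul_apply {α : Type*} (f g : Function.End α) (x : α) : (f * g) x = f (g x) := rfl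

open Classical in
-- The sign counts the hits of `x.1` among the dihedral reflections `b * (a * b) ^ n` crossed by the
-- word `(a b)^k`.
theorem signedConj_mul_pow {a b : W} (ha : a * a = 1) (hb : b * b = 1) (k : ℕ)
    (x : W × ZMod 2) :
    ((signedConj a * signedConj b) ^ k) x = ((a * b) ^ k * x.1 * ((a * b) ^ k)⁻¹,
      x.2 + ∑ n ∈ Finset.range (2 * k), if x.1 = b * (a * b) ^ n then 1 else 0) := by
  have ha' : a⁻¹ = a := inv_eq_of_mul_eq_one_right ha
  have hb' : b⁻¹ = b := inv_eq_of_mul_eq_one_right hb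
  have hr : ∀ n : ℕ, (a * b) ^ n * b = b * ((a * b) ^ n)⁻¹ := by
    intro n
    have h1 : SemiconjBy b (a * b)⁻¹ (a * b) := by
      simp only [SemiconjBy, mul_inv_rev, ha', hb']
      rw [← mul_assoc, hb, one_mul, mul_assoc, hb, mul_one]
    have := h1.pow_right n
    rw [inv_pow] at this
    exact this.eq.symm
  induction k with
  | zero => simp; rfl
  | succ k ih =>
    rw [pow_succ', end_mul_apply, ih]
    have e1 : (a * b) ^ k * x.1 * ((a * b) ^ k)⁻¹ = b ↔ x.1 = b * (a * b) ^ (2 * k) := by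
      rw [mul_inv_eq_iff_eq_mul, ← eq_inv_mul_iff_mul_eq, two_mul, pow_add]
      have : ((a * b) ^ k)⁻¹ * b = b * (a * b) ^ k := by
        rw [inv_mul_eq_iff_eq_mul, ← mul_assoc, hr, inv_mul_cancel_right]
      rw [← mul_assoc, this, mul_assoc]
    have e2 : b * ((a * b) ^ k * x.1 * ((a * b) ^ k)⁻¹) * b⁻¹ = a ↔
        x.1 = b * (a * b) ^ (2 * k + 1) := by
      have : b * ((a * b) ^ k * x.1 * ((a * b) ^ k)⁻¹) * b⁻¹ =
        (b * (a * b) ^ k) * x.1 * (b * (a * b) ^ k)⁻¹ := by group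
      rw [this, mul_inv_eq_iff_eq_mul, ← eq_inv_mul_iff_mul_eq]
      have : (b * (a * b) ^ k)⁻¹ * (a * (b * (a * b) ^ k)) = b * (a * b) ^ (2 * k + 1) := by
        have h1 : b * (a * b) ^ k * b = ((a * b) ^ k)⁻¹ := by
          rw [mul_assoc, hr, ← mul_assoc, hb, one_mul]
        rw [inv_mul_eq_iff_eq_mul, ← mul_assoc a b, ← mul_assoc (b * _) b, h1, ← pow_succ',
          show 2 * k + 1 = k + (k + 1) by ring, pow_add _ k (k + 1), inv_mul_cancel_left]
      rw [this]
    simp only [signedConj, end_mul_apply]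
    rw [show 2 * (k + 1) = 2 * k + 1 + 1 by ring, Finset.sum_range_succ, Finset.sum_range_succ]
    simp only [e1, e2, Prod.mk.injEq]
    refine ⟨?_, by ring⟩
    have : a * (b * ((a * b) ^ k * x.1 * ((a * b) ^ k)⁻¹) * b⁻¹) * a⁻¹ =
      a * b * ((a * b) ^ k * x.1 * ((a * b) ^ k)⁻¹) * (a * b)⁻¹ := by group
    rw [this, pow_succ']
    generalize a * b = r
    group

/-- For `k = M i j` the list of `2k` reflections runs twice through the same `k` terms, so the sign
vanishes modulo `2`. -/
theorem signedConj_isLiftable : M.IsLiftable fun i => signedConj (cs.simple i) := by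
  classical
  intro i j
  funext x
  rw [signedConj_mul_pow (cs.simple_mul_simple_self i) (cs.simple_mul_simple_self j),
    cs.simple_mul_simple_pow, two_mul, Finset.sum_range_add]
  simp only [pow_add, cs.simple_mul_simple_pow, one_mul]
  rw [← two_mul, show (2 : ZMod 2) = 0 from rfl]
  simp
  rfl

/-- The sign cocycle: the sign by which `w` acts on the pair `(t, 0)`. -/
noncomputable def signCocycle (w t : W) : ZMod 2 :=
  (cs.lift ⟨_, signedConj_isLiftable cs⟩ w (t, 0)).2

theorem lift_signedConj (w : W) (x : W × ZMod 2) :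
    cs.lift ⟨_, signedConj_isLiftable cs⟩ w x = (w * x.1 * w⁻¹, x.2 + signCocycle cs w x.1) := by
  have key : ∀ x : W × ZMod 2, ∀ a : ZMod 2,
      cs.lift ⟨_, signedConj_isLiftable cs⟩ w (x.1, x.2 + a) =
      (w * x.1 * w⁻¹, (cs.lift ⟨_, signedConj_isLiftable cs⟩ w x).2 + a) := by
    induction w using cs.simple_induction_left with
    | one =>
      intro x a
      simp [Function.End.one_def]
    | mul_simple_left w i ih =>
      intro x a
      have h0 := ih x 0
      rw [add_zero, add_zero] at h0
      simp only [map_mul, end_mul_apply, cs.lift_apply_simple]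
      rw [ih, h0]
      simp only [signedConj, mul_inv_rev, Prod.mk.injEq]
      exact ⟨by group, by ring⟩
  have h1 := key (x.1, 0) x.2
  simp only [zero_add] at h1
  rw [h1, signCocycle, add_comm]

theorem signCocycle_mul (v w t : W) :
    signCocycle cs (v * w) t = signCocycle cs w t + signCocycle cs v (w * t * w⁻¹) := by
  rw [signCocycle, map_mul, end_mul_apply, lift_signedConj,
    lift_signedConj]
  simp

open Classical in
theorem signCocycle_simple (i : B) (t : W) :
    signCocycle cs (cs.simple i) t = if t = cs.simple i then 1 else 0 := by
  rw [signCocycle, cs.lift_apply_simple]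
  simp [signedConj]

/-- The half-space of `s` consists of those `w` for which a gallery from `1` to `w` crosses the wall
of `s` an even number of times. The cocycle makes this parity independent of the gallery. -/
theorem halfSystem_range_simple :
    HalfSystem (Set.range cs.simple) fun s w => signCocycle cs w⁻¹ s = 0 where
  mul_self := by
    rintro _ ⟨i, rfl⟩
    exact cs.simple_mul_simple_self i
  closure := cs.subgroup_closure_range_simple
  one := by
    rintro _ ⟨i, rfl⟩
    simp [signCocycle, Function.End.one_def]
  not_mul := by
    rintro _ ⟨i, rfl⟩ w hw
    rw [mul_inv_rev, signCocycle_mul, cs.inv_simple, signCocycle_simple]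
    simp [hw]
  comm := by
    rintro _ ⟨i, rfl⟩ _ ⟨j, rfl⟩ w hw h1
    rw [mul_inv_rev, signCocycle_mul, hw, cs.inv_simple, signCocycle_simple, zero_add] at h1
    have h2 : w⁻¹ * cs.simple i * w⁻¹⁻¹ = cs.simple j := by
      by_contra h3
      exact h1 (if_neg h3)
    rw [inv_inv, mul_assoc, inv_mul_eq_iff_eq_mul] at h2
    exact h2

end Coxeter

end KL

namespace KL

/-! ### The fixed-point group as a group with half-spaces. -/

section FixedPoints

variable {W : Type*} [Group W] {S : Set W} {P : W → W → Prop} {G : Subgroup (MulAut W)}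

theorem wordLength_map_le (h : HalfSystem S P) {σ : MulAut W} (hσ : (fun w => σ w) '' S = S)
    (w : W) : wordLength S (σ w) ≤ wordLength S w := by
  obtain ⟨l, hl, rfl, hx⟩ := h.exists_word w
  rw [← hx, map_list_prod, ← List.length_map (as := l) σ]
  refine wordLength_prod_le fun s hs => ?_
  obtain ⟨t, ht, rfl⟩ := List.mem_map.1 hs
  exact hσ ▸ ⟨t, hl t ht, rfl⟩

theorem wordLength_smul (h : HalfSystem S P) (hGS : ∀ σ ∈ G, (fun w => σ w) '' S = S) (σ : G)
    (w : W) : wordLength S (σ • w) = wordLength S w := by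
  refine le_antisymm (wordLength_map_le h (hGS σ σ.2) w) ?_
  have := wordLength_map_le h (hGS (σ⁻¹ : G) (σ⁻¹ : G).2) (σ • w)
  change wordLength S (σ⁻¹ • σ • w) ≤ _ at this
  rwa [inv_smul_smul] at this

theorem orbit_subset (hGS : ∀ σ ∈ G, (fun w => σ w) '' S = S) {s : W} (hs : s ∈ S) :
    MulAction.orbit G s ⊆ S := by
  rintro _ ⟨σ, rfl⟩
  have := hGS σ σ.2
  exact this ▸ ⟨s, hs, rfl⟩

theorem smul_mem_closure_orbit (σ : G) {s w : W}
    (hw : w ∈ Subgroup.closure (MulAction.orbit G s)) :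
    σ • w ∈ Subgroup.closure (MulAction.orbit G s) := by
  induction hw using Subgroup.closure_induction with
  | mem x hx => exact Subgroup.subset_closure (MulAction.mem_orbit_of_mem_orbit σ hx)
  | one => rw [smul_one]; exact one_mem _
  | mul x y _ _ hx hy => rw [smul_mul']; exact mul_mem hx hy
  | inv x _ hx => rw [smul_inv']; exact inv_mem hx

/-- An automorphism in `G` fixes `w`, preserves length, and can move `t` to any element of its
orbit. -/
theorem forall_descent_of_descent (h : HalfSystem S P)
    (hGS : ∀ σ ∈ G, (fun w => σ w) '' S = S) {s : W} (w : FixedPoints.subgroup G W)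
    {t : W} (ht : t ∈ MulAction.orbit G s) (hw : wordLength S (t * w) < wordLength S (w : W)) :
    ∀ u ∈ MulAction.orbit G s, wordLength S (u * w) < wordLength S (w : W) := by
  intro u hu
  rw [← MulAction.orbit_eq_iff.2 ht] at hu
  obtain ⟨σ, rfl⟩ := hu
  have : σ • t * (w : W) = σ • (t * (w : W)) := by rw [smul_mul', w.2 σ]
  change wordLength S (σ • t * w) < _
  rwa [this, wordLength_smul h hGS]

theorem descents_or_ascents (h : HalfSystem S P)
    (hGS : ∀ σ ∈ G, (fun w => σ w) '' S = S) {s : W} (hs : s ∈ S)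
    (w : FixedPoints.subgroup G W) :
    (∀ u ∈ MulAction.orbit G s, wordLength S (u * w) < wordLength S (w : W)) ∨
      ∀ u ∈ MulAction.orbit G s, wordLength S (w : W) < wordLength S (u * w) := by
  by_cases h1 : ∃ t ∈ MulAction.orbit G s, wordLength S (t * w) < wordLength S (w : W)
  · obtain ⟨t, ht, h2⟩ := h1
    exact Or.inl (forall_descent_of_descent h hGS w ht h2)
  · refine Or.inr fun u hu => ?_
    push Not at h1
    have := h1 u hu
    have := h.wordLength_simple_mul (orbit_subset hGS hs hu) (w : W)
    lia

theorem wordLength_fixedSimple_mul (h : HalfSystem S P)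
    (hGS : ∀ σ ∈ G, (fun w => σ w) '' S = S) {s : W} (hs : s ∈ S)
    {x : W} (hx : IsLongest S (MulAction.orbit G s) x) (w : FixedPoints.subgroup G W) :
    ((∀ u ∈ MulAction.orbit G s, wordLength S (u * w) < wordLength S (w : W)) ∧
      wordLength S (w : W) = wordLength S x + wordLength S (x * w)) ∨
      (∀ u ∈ MulAction.orbit G s, wordLength S (w : W) < wordLength S (u * w)) ∧
      wordLength S (x * w) = wordLength S x + wordLength S (w : W) := by
  have hI := orbit_subset hGS hs
  rcases descents_or_ascents h hGS hs w with h1 | h1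
  · refine Or.inl ⟨h1, ?_⟩
    obtain ⟨d, h2, h3⟩ := h.exists_factor hI h1 hx.1
    rw [h3, h2, ← mul_assoc, h.isLongest_mul_self hI hx, one_mul]
  · exact Or.inr ⟨h1, h.wordLength_mul_of_ascents hI h1 hx.1⟩

theorem wordLength_isLongest_pos (h : HalfSystem S P)
    (hGS : ∀ σ ∈ G, (fun w => σ w) '' S = S) {s : W} (hs : s ∈ S)
    {x : W} (hx : IsLongest S (MulAction.orbit G s) x) : 0 < wordLength S x := by
  have := h.descent_of_isLongest (orbit_subset hGS hs) hx (MulAction.mem_orbit_self s)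
  lia

theorem eq_one_or_eq_of_mem_closure_orbit (h : HalfSystem S P)
    (hGS : ∀ σ ∈ G, (fun w => σ w) '' S = S) {s : W} (hs : s ∈ S)
    {x : W} (hx : IsLongest S (MulAction.orbit G s) x) (w : FixedPoints.subgroup G W)
    (hw : (w : W) ∈ Subgroup.closure (MulAction.orbit G s)) : (w : W) = 1 ∨ (w : W) = x := by
  by_cases h1 : (w : W) = 1
  · exact Or.inl h1
  · obtain ⟨t, ht, h2⟩ := h.exists_descent (orbit_subset hGS hs) hw h1
    exact Or.inr (h.isLongest_unique (orbit_subset hGS hs) hx hw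
      (forall_descent_of_descent h hGS w ht h2))

theorem isLongest_orbit_fixed (h : HalfSystem S P)
    (hGS : ∀ σ ∈ G, (fun w => σ w) '' S = S) {s : W} (hs : s ∈ S)
    {x : W} (hx : IsLongest S (MulAction.orbit G s) x) : x ∈ FixedPoints.subgroup G W := by
  intro σ
  have h1 : IsLongest S (MulAction.orbit G s) (σ • x) :=
    ⟨smul_mem_closure_orbit σ hx.1, fun v hv => by
      rw [wordLength_smul h hGS]; exact hx.2 v hv⟩
  exact h.isLongest_unique (orbit_subset hGS hs) hx h1.1
    fun t ht => h.descent_of_isLongest (orbit_subset hGS hs) h1 ht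

/-- A simple descent of a fixed element spreads to its whole orbit, which is finite because `G` is.
Hence the parabolic subgroup is finite and has a longest element: orbits with infinite `⟨ω⟩` never
give descents. -/
theorem exists_fixedSimple_descent [Finite G] (h : HalfSystem S P)
    (hGS : ∀ σ ∈ G, (fun w => σ w) '' S = S) (w : FixedPoints.subgroup G W) (hw : w ≠ 1) :
    ∃ x ∈ fixedSimple S G, wordLength S (x * w : W) < wordLength S (w : W) := by
  obtain ⟨s, hs, h1⟩ := h.exists_descent subset_rfl (c := (w : W))
    (h.closure ▸ Subgroup.mem_top _) (by simpa using hw)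
  have hI := orbit_subset hGS hs
  have h2 := forall_descent_of_descent h hGS w (MulAction.mem_orbit_self s) h1
  have hfin := h.finite_closure_of_descents hI (Set.finite_range _) h2
  obtain ⟨x, hx⟩ := HalfSystem.exists_isLongest (S := S) hfin
  refine ⟨⟨x, isLongest_orbit_fixed h hGS hs hx⟩, ⟨s, hs, hfin, hx⟩, ?_⟩
  have h3 := wordLength_isLongest_pos h hGS hs hx
  rcases wordLength_fixedSimple_mul h hGS hs hx w with ⟨-, h4⟩ | ⟨h4, -⟩
  · simp only
    lia
  · exact absurd (h4 s (MulAction.mem_orbit_self s)) (by lia)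

/-- Each `u` in the orbit of `x` lengthens `w` and shortens `w * y`, so exchange deletes a letter of
`y` and puts `w⁻¹ * u * w` in the parabolic subgroup of `y`. Hence `w⁻¹ * x * w` is a non-trivial
fixed point there, and the only one is `y`. -/
theorem fixedSimple_comm (h : HalfSystem S P)
    (hGS : ∀ σ ∈ G, (fun w => σ w) '' S = S) {x y : FixedPoints.subgroup G W}
    (hx : x ∈ fixedSimple S G) (hy : y ∈ fixedSimple S G) (w : FixedPoints.subgroup G W)
    (h1 : wordLength S (w : W) < wordLength S (x * w : W))
    (h2 : ¬ wordLength S (w * y : W) < wordLength S (x * (w * y) : W)) : x * w = w * y := by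
  obtain ⟨s, hs, -, hx⟩ := hx
  obtain ⟨t, ht, -, hy⟩ := hy
  have hI := orbit_subset hGS hs
  have hJ := orbit_subset hGS ht
  have hx0 := wordLength_isLongest_pos h hGS hs hx
  have hw : ∀ u ∈ MulAction.orbit G s, wordLength S (w : W) < wordLength S (u * w) := by
    rcases wordLength_fixedSimple_mul h hGS hs hx w with ⟨-, h3⟩ | ⟨h3, -⟩
    · lia
    · exact h3
  have hwy : ∀ u ∈ MulAction.orbit G s,
      wordLength S (u * (w * y) : W) < wordLength S (w * y : W) := by
    rcases wordLength_fixedSimple_mul h hGS hs hx (w * y) with ⟨h3, -⟩ | ⟨-, h3⟩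
    · exact h3
    · rw [Subgroup.coe_mul] at h3
      lia
  have hconj : ∀ u ∈ MulAction.orbit G s,
      (w : W)⁻¹ * u * w ∈ Subgroup.closure (MulAction.orbit G t) := by
    intro u hu
    obtain ⟨l, hl, h3, -⟩ := h.exists_parabolic_word hJ hy.1
    obtain ⟨l', h4, -, h5⟩ := h.exchange (hI hu) (fun v hv => hJ (hl v hv)) (hw u hu)
      (by rw [h3]; exact hwy u hu)
    have h6 : (w : W)⁻¹ * u * w = l'.prod * (y : W)⁻¹ := by
      rw [eq_mul_inv_iff_mul_eq, mul_assoc, mul_assoc, ← h3, h5, inv_mul_cancel_left]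
    rw [h6]
    exact mul_mem (Subgroup.list_prod_mem _ fun v hv => Subgroup.subset_closure
      (hl v (h4.subset hv))) (inv_mem hy.1)
  have hv : (w : W)⁻¹ * x * w ∈ Subgroup.closure (MulAction.orbit G t) := by
    have h3 : Subgroup.closure (MulAction.orbit G s) ≤
        (Subgroup.closure (MulAction.orbit G t)).comap (MulAut.conj (w : W)⁻¹).toMonoidHom := by
      rw [Subgroup.closure_le]
      intro u hu
      simpa using hconj u hu
    simpa using h3 hx.1
  have h3 : w⁻¹ * x * w = y := by
    rcases eq_one_or_eq_of_mem_closure_orbit h hGS ht hy (w⁻¹ * x * w) (by simpa using hv)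
      with h4 | h4
    · exfalso
      have h5 : (x : W) = 1 := by
        have : w⁻¹ * x * w = 1 := Subtype.ext h4
        have : x = 1 := by simpa [mul_assoc, inv_mul_eq_one, eq_comm] using this
        simp [this]
      rw [h5, wordLength_one] at hx0
      exact lt_irrefl _ hx0
    · exact Subtype.ext h4
  rw [← h3]
  group

theorem halfSystem_fixedSimple [Finite G] (h : HalfSystem S P)
    (hGS : ∀ σ ∈ G, (fun w => σ w) '' S = S) :
    HalfSystem (fixedSimple S G)
      fun x w => wordLength S (w : W) < wordLength S (x * w : W) where
  mul_self := by
    rintro x ⟨s, hs, -, hx⟩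
    exact Subtype.ext (h.isLongest_mul_self (orbit_subset hGS hs) hx)
  closure := by
    rw [eq_top_iff]
    rintro w -
    induction hn : wordLength S (w : W) using Nat.strong_induction_on generalizing w with
    | _ n ih =>
      by_cases hw : w = 1
      · exact hw ▸ one_mem _
      · obtain ⟨x, hx, h1⟩ := exists_fixedSimple_descent h hGS w hw
        have h2 := ih _ (hn ▸ h1) (w := x * w) rfl
        rw [← inv_mul_cancel_left x w]
        exact mul_mem (inv_mem (Subgroup.subset_closure hx)) h2
  one := by
    rintro x ⟨s, hs, -, hx⟩
    simpa [wordLength_one] using wordLength_isLongest_pos h hGS hs hx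
  not_mul := by
    rintro x ⟨s, hs, -, hx⟩ w hw
    have : (x : W) * (x * w) = w := by
      rw [← mul_assoc, h.isLongest_mul_self (orbit_subset hGS hs) hx, one_mul]
    rw [Subgroup.coe_mul, this]
    exact hw.not_gt
  comm := fun x hx y hy w h1 h2 => fixedSimple_comm h hGS hx hy w h1 h2

/-- Prefixing one element of `S_G` that raises the length for `S_G` also adds lengths for `S`, so
reduced products stay reduced in `W`. In particular `φ` restricts to a weight function. -/
theorem wordLength_mul_of_fixed [Finite G] (h : HalfSystem S P)
    (hGS : ∀ σ ∈ G, (fun w => σ w) '' S = S) (w w' : FixedPoints.subgroup G W)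
    (hw : wordLength (fixedSimple S G) (w * w') =
      wordLength (fixedSimple S G) w + wordLength (fixedSimple S G) w') :
    wordLength S (w * w' : W) = wordLength S (w : W) + wordLength S (w' : W) := by
  have hG := halfSystem_fixedSimple h hGS
  have key : ∀ x ∈ fixedSimple S G, ∀ w : FixedPoints.subgroup G W,
      wordLength (fixedSimple S G) w < wordLength (fixedSimple S G) (x * w) →
      wordLength S (x * w : W) = wordLength S (x : W) + wordLength S (w : W) := by
    intro x hx w h1
    rw [← hG.iff_lt hx] at h1
    obtain ⟨s, hs, -, hx⟩ := hx
    rcases wordLength_fixedSimple_mul h hGS hs hx w with ⟨-, h3⟩ | ⟨-, h3⟩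
    · lia
    · exact h3
  induction w using hG.induction with
  | one => simp [wordLength_one]
  | mul x hx c h1 ih =>
    have h2 := hG.wordLength_mul_le x (c * w')
    have h3 := hG.wordLength_mul_le c w'
    have h4 := hG.wordLength_simple hx
    rw [mul_assoc] at hw
    have h5 := key x hx c (by lia)
    have h6 := key x hx (c * w') (by lia)
    have h7 := ih (by lia)
    rw [Subgroup.coe_mul] at h6
    rw [Subgroup.coe_mul, mul_assoc, h6, h7, h5, add_assoc]

theorem isWeightFunction_fixedWeight [Finite G] {Γ : Type*} [Add Γ] {φ : W → Γ}
    (h : HalfSystem S P) (hGS : ∀ σ ∈ G, (fun w => σ w) '' S = S) (hφ : IsWeightFunction S φ) :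
    IsWeightFunction (fixedSimple S G) (fixedWeight φ G) :=
  fun w w' hw => hφ w w' (wordLength_mul_of_fixed h hGS w w' hw)

end FixedPoints

end KL

namespace KL

noncomputable section

variable {W : Type*} [Group W] {Γ : Type*} [AddCommGroup Γ]
  {S : Set W} {φ : W → Γ} {P : W → W → Prop}

/-! ### The Hecke algebra: relations, universal property, spanning by the `T_w`. -/

section Generalities

theorem expo_zero : expo (0 : Γ) = 1 := rfl

theorem expo_add (a b : Γ) : expo (a + b) = expo a * expo b := by
  simp [expo, AddMonoidAlgebra.single_mul_single]

theorem expo_mul_neg (a : Γ) : expo a * expo (-a) = 1 := by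
  rw [← expo_add, add_neg_cancel, expo_zero]

/-- The coefficient `e ^ φ(s) - e ^ (-φ(s))` of the quadratic relation. -/
def xi (φ : W → Γ) (s : W) : ℤ[Γ] := expo (φ s) - expo (-φ s)

theorem mk_eq_of_rel {a b : FreeAlgebra ℤ[Γ] W} (h : HeckeRel S φ a b) :
    mk S φ a = mk S φ b :=
  RingQuot.mkAlgHom_rel ℤ[Γ] h

theorem T_one : T S φ 1 = 1 := by
  rw [T, mk_eq_of_rel HeckeRel.one, map_one]

theorem T_mul (w w' : W) (h : wordLength S (w * w') = wordLength S w + wordLength S w') :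
    T S φ w * T S φ w' = T S φ (w * w') := by
  rw [T, T, ← map_mul, mk_eq_of_rel (HeckeRel.mul w w' h), T]

theorem T_quadratic {s : W} (hs : s ∈ S) :
    (T S φ s - algebraMap ℤ[Γ] _ (expo (φ s))) * (T S φ s + algebraMap ℤ[Γ] _ (expo (-φ s))) =
      0 := by
  have := mk_eq_of_rel (HeckeRel.quadratic (φ := φ) s hs)
  rw [map_mul, map_sub, map_add, AlgHom.commutes, AlgHom.commutes, map_zero] at this
  exact this

theorem T_mul_self {s : W} (hs : s ∈ S) : T S φ s * T S φ s = 1 + xi φ s • T S φ s := by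
  have h := T_quadratic (φ := φ) hs
  have h1 : algebraMap ℤ[Γ] (Hecke S φ) (expo (φ s)) * algebraMap ℤ[Γ] _ (expo (-φ s)) = 1 := by
    rw [← map_mul, expo_mul_neg, map_one]
  have h2 := Algebra.commutes (expo (-φ s)) (T S φ s)
  rw [Algebra.smul_def, xi, map_sub]
  rw [sub_mul, mul_add, mul_add, h1, ← h2, sub_eq_zero] at h
  rw [eq_sub_of_add_eq h, sub_mul]
  abel

theorem IsWeightFunction.one (hφ : IsWeightFunction S φ) : φ 1 = 0 := by
  simpa [wordLength_one] using hφ 1 1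

/-- Algebra homomorphisms out of the Hecke algebra. -/
def heckeLift {R : Type*} [Ring R] [Algebra ℤ[Γ] R] (f : W → R) (one : f 1 = 1)
    (mul : ∀ w w', wordLength S (w * w') = wordLength S w + wordLength S w' →
      f w * f w' = f (w * w'))
    (quadratic : ∀ s ∈ S, (f s - algebraMap ℤ[Γ] R (expo (φ s))) *
      (f s + algebraMap ℤ[Γ] R (expo (-φ s))) = 0) : Hecke S φ →ₐ[ℤ[Γ]] R :=
  RingQuot.liftAlgHom ℤ[Γ] ⟨FreeAlgebra.lift ℤ[Γ] f, by
    rintro _ _ (_ | ⟨w, w', h⟩ | ⟨s, hs⟩)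
    · simpa using one
    · simpa using mul w w' h
    · simpa using quadratic s hs⟩

theorem heckeLift_T {R : Type*} [Ring R] [Algebra ℤ[Γ] R] (f : W → R) (one mul quadratic)
    (w : W) : heckeLift (S := S) (φ := φ) f one mul quadratic (T S φ w) = f w := by
  simp only [heckeLift, T, mk]
  erw [RingQuot.liftAlgHom_mkAlgHom_apply]
  simp

theorem adjoin_T : Algebra.adjoin ℤ[Γ] (Set.range (T S φ)) = ⊤ := by
  have h1 : Set.range (T S φ) = mk S φ '' Set.range (FreeAlgebra.ι ℤ[Γ]) := by
    rw [← Set.range_comp]; rfl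
  rw [h1, ← AlgHom.map_adjoin, FreeAlgebra.adjoin_range_ι, Algebra.map_top,
    AlgHom.range_eq_top]
  exact RingQuot.mkAlgHom_surjective _ _

end Generalities

theorem T_simple_mul (h : HalfSystem S P) {s : W} (hs : s ∈ S) (w : W) :
    T S φ s * T S φ w = T S φ (s * w) ∨
      wordLength S (s * w) < wordLength S w ∧
      T S φ s * T S φ w = T S φ (s * w) + xi φ s • T S φ w := by
  have h0 := h.wordLength_simple hs
  rcases h.wordLength_simple_mul hs w with h1 | h1
  · exact Or.inl (T_mul _ _ (by lia))
  · refine Or.inr ⟨by lia, ?_⟩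
    have h2 : T S φ s * T S φ (s * w) = T S φ w := by
      rw [T_mul _ _ (by rw [h.cancel hs]; lia), h.cancel hs]
    rw [← h2, ← mul_assoc, T_mul_self hs, add_mul, one_mul, smul_mul_assoc]

theorem span_T (h : HalfSystem S P) : Submodule.span ℤ[Γ] (Set.range (T S φ)) = ⊤ := by
  set V := Submodule.span ℤ[Γ] (Set.range (T S φ))
  have hT : ∀ w, T S φ w ∈ V := fun w => Submodule.subset_span ⟨w, rfl⟩
  have hs : ∀ s ∈ S, ∀ v ∈ V, T S φ s * v ∈ V := by
    intro s hs v hv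
    induction hv using Submodule.span_induction with
    | mem x hx =>
      obtain ⟨w, rfl⟩ := hx
      rcases T_simple_mul (φ := φ) h hs w with h1 | ⟨-, h1⟩
      · exact h1 ▸ hT _
      · exact h1 ▸ V.add_mem (hT _) (V.smul_mem _ (hT _))
    | zero => simp
    | add x y _ _ hx hy => rw [mul_add]; exact V.add_mem hx hy
    | smul a x _ hx => rw [mul_smul_comm]; exact V.smul_mem _ hx
  have hw : ∀ w, ∀ v ∈ V, T S φ w * v ∈ V := by
    intro w
    induction w using h.induction with
    | one => simp [T_one]
    | mul s h0 c h1 ih =>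
      intro v hv
      rw [← T_mul s c (by rw [h1, h.wordLength_simple h0, add_comm]), mul_assoc]
      exact hs s h0 _ (ih v hv)
  let A : Subalgebra ℤ[Γ] (Hecke S φ) :=
    V.toSubalgebra (T_one (S := S) (φ := φ) ▸ hT 1) fun x y hx hy => by
      induction hx using Submodule.span_induction with
      | mem x hx =>
        obtain ⟨w, rfl⟩ := hx
        exact hw w y hy
      | zero => simp
      | add x x' _ _ hx hx' => rw [add_mul]; exact V.add_mem hx hx'
      | smul a x _ hx => rw [smul_mul_assoc]; exact V.smul_mem _ hx
  have hA : A = ⊤ := by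
    rw [eq_top_iff, ← adjoin_T, Algebra.adjoin_le_iff]
    rintro _ ⟨w, rfl⟩
    exact hT w
  rw [eq_top_iff]
  intro x _
  have : x ∈ A := hA ▸ Algebra.mem_top
  exact this

/-! ### Linear independence of the `T_w` through the regular representation. -/

section RegularRepresentation

/-- Left multiplication by `T_s` on the free module with basis `W`. -/
def leftOp (S : Set W) (φ : W → Γ) (s : W) : Module.End ℤ[Γ] (W →₀ ℤ[Γ]) :=
  Finsupp.linearCombination ℤ[Γ] fun w => Finsupp.single (s * w) 1 +
    (if wordLength S (s * w) < wordLength S w then xi φ s else 0) • Finsupp.single w 1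

/-- Right multiplication by `T_t` on the free module with basis `W`. -/
def rightOp (S : Set W) (φ : W → Γ) (t : W) : Module.End ℤ[Γ] (W →₀ ℤ[Γ]) :=
  Finsupp.linearCombination ℤ[Γ] fun w => Finsupp.single (w * t) 1 +
    (if wordLength S (w * t) < wordLength S w then xi φ t else 0) • Finsupp.single w 1

theorem leftOp_single (s w : W) : leftOp S φ s (Finsupp.single w 1) = Finsupp.single (s * w) 1 +
    (if wordLength S (s * w) < wordLength S w then xi φ s else 0) • Finsupp.single w 1 := by
  rw [leftOp, Finsupp.linearCombination_single, one_smul]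

theorem rightOp_single (t w : W) : rightOp S φ t (Finsupp.single w 1) =
    Finsupp.single (w * t) 1 +
    (if wordLength S (w * t) < wordLength S w then xi φ t else 0) • Finsupp.single w 1 := by
  rw [rightOp, Finsupp.linearCombination_single, one_smul]

theorem leftOp_single_of_lt {s w : W} (h : wordLength S w < wordLength S (s * w)) :
    leftOp S φ s (Finsupp.single w 1) = Finsupp.single (s * w) 1 := by
  rw [leftOp_single, if_neg h.not_gt, zero_smul, add_zero]

theorem rightOp_single_of_lt {t w : W} (h : wordLength S w < wordLength S (w * t)) :
    rightOp S φ t (Finsupp.single w 1) = Finsupp.single (w * t) 1 := by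
  rw [rightOp_single, if_neg h.not_gt, zero_smul, add_zero]

theorem weight_eq_of_fold (h : HalfSystem S P) (hφ : IsWeightFunction S φ) {s t w : W}
    (hs : s ∈ S) (ht : t ∈ S) (hw : s * w = w * t) : φ s = φ t := by
  have hs1 := h.wordLength_simple hs
  have ht1 := h.wordLength_simple ht
  rcases h.wordLength_simple_mul hs w with h1 | h1
  · have h2 := hφ s w (by lia)
    have h3 := hφ w t (by rw [← hw]; lia)
    rw [← hw, h2, add_comm] at h3
    exact add_left_cancel h3
  · have h2 := hφ s (s * w) (by rw [h.cancel hs]; lia)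
    have h3 := hφ (w * t) t (by rw [h.cancel_right ht, ← hw]; lia)
    rw [h.cancel hs] at h2
    rw [h.cancel_right ht, h2, hw, add_comm] at h3
    exact add_left_cancel h3

/-- If `s * w ≠ w * t`, folding shows that `s` being a descent is unaffected by `t`, and conversely.
If `s * w = w * t`, the correction terms match because `φ s = φ t`; the weight property enters here.
-/
theorem leftOp_commute_rightOp (h : HalfSystem S P) (hφ : IsWeightFunction S φ) {s t : W}
    (hs : s ∈ S) (ht : t ∈ S) : Commute (leftOp S φ s) (rightOp S φ t) := by
  refine Finsupp.lhom_ext' fun w => LinearMap.ext_ring ?_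
  simp only [LinearMap.comp_apply, Finsupp.lsingle_apply, Module.End.mul_apply]
  simp only [leftOp_single, rightOp_single, map_add, map_smul, ← mul_assoc]
  by_cases hw : s * w = w * t
  · have hxi : xi φ s = xi φ t := by rw [xi, xi, weight_eq_of_fold h hφ hs ht hw]
    have h1 : s * w * t = w := by rw [hw, h.cancel_right ht]
    rw [h1, ← hw, hxi]
  · have e1 : wordLength S (s * w * t) < wordLength S (w * t) ↔
        wordLength S (s * w) < wordLength S w := by
      have h1 := h.wordLength_simple_mul hs w
      have h2 := h.wordLength_simple_mul hs (w * t)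
      rw [mul_assoc]
      constructor
      · intro h3
        by_contra h4
        exact hw (h.fold hs ht (by lia) h3)
      · intro h3
        by_contra h4
        have h5 := h.fold hs ht (w := w * t) (by lia) (by rwa [h.cancel_right ht])
        rw [h.cancel_right ht] at h5
        exact hw (by rw [← h.cancel hs (w * t), h5])
    have e2 : wordLength S (s * w * t) < wordLength S (s * w) ↔
        wordLength S (w * t) < wordLength S w := by
      have h1 := h.wordLength_simple_mul hs w
      have h2 := h.wordLength_simple_mul hs (w * t)
      have h3 := h.wordLength_mul_simple ht w
      have h4 := h.wordLength_mul_simple ht (s * w)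
      rw [← mul_assoc] at h2
      lia
    simp only [e1, e2]
    split_ifs <;> module

/-- The right operators generate the whole module from the basis vector at `1`. All Hecke relations
between left operators can therefore be checked on that vector. -/
theorem end_ext_of_commute (h : HalfSystem S P) {f g : Module.End ℤ[Γ] (W →₀ ℤ[Γ])}
    (hf : ∀ t ∈ S, Commute f (rightOp S φ t)) (hg : ∀ t ∈ S, Commute g (rightOp S φ t))
    (hfg : f (Finsupp.single 1 1) = g (Finsupp.single 1 1)) : f = g := by
  refine Finsupp.lhom_ext' fun w => LinearMap.ext_ring ?_
  simp only [LinearMap.comp_apply, Finsupp.lsingle_apply]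
  induction w using h.induction_right with
  | one => exact hfg
  | mul t ht c h1 ih =>
    rw [← rightOp_single_of_lt (S := S) (φ := φ) (by lia), ← Module.End.mul_apply, (hf t ht).eq,
      Module.End.mul_apply, ih, ← Module.End.mul_apply, ← (hg t ht).eq, Module.End.mul_apply]

theorem exists_leftOp (h : HalfSystem S P) (hφ : IsWeightFunction S φ) (w : W) :
    ∃ f : Module.End ℤ[Γ] (W →₀ ℤ[Γ]), (∀ t ∈ S, Commute f (rightOp S φ t)) ∧
      ∀ w', wordLength S (w * w') = wordLength S w + wordLength S w' →
        f (Finsupp.single w' 1) = Finsupp.single (w * w') 1 := by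
  induction w using h.induction with
  | one => exact ⟨1, fun t _ => Commute.one_left _, fun w' _ => by simp⟩
  | mul s hs c h1 ih =>
    obtain ⟨f, h2, h3⟩ := ih
    refine ⟨leftOp S φ s * f, fun t ht => (leftOp_commute_rightOp h hφ hs ht).mul_left (h2 t ht),
      fun w' hw' => ?_⟩
    have h4 := h.wordLength_mul_le c w'
    have h5 := h.wordLength_simple_mul hs (c * w')
    rw [mul_assoc] at hw'
    rw [Module.End.mul_apply, h3 w' (by lia), leftOp_single_of_lt (by lia), mul_assoc]

/-- The regular representation of the Hecke algebra. -/
theorem exists_regularRepresentation (h : HalfSystem S P) (hφ : IsWeightFunction S φ) :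
    ∃ ρ : Hecke S φ →ₐ[ℤ[Γ]] Module.End ℤ[Γ] (W →₀ ℤ[Γ]),
      ∀ w, ρ (T S φ w) (Finsupp.single 1 1) = Finsupp.single w 1 := by
  choose f h1 h2 using exists_leftOp h hφ
  have h3 : ∀ w, f w (Finsupp.single 1 1) = Finsupp.single w 1 := fun w => by
    simpa [wordLength_one] using h2 w 1
  have h4 : ∀ a : ℤ[Γ], ∀ t, Commute (algebraMap _ (Module.End ℤ[Γ] (W →₀ ℤ[Γ])) a)
    (rightOp S φ t) := fun a t => Algebra.commutes _ _
  refine ⟨heckeLift f (end_ext_of_commute h (h1 1) (fun t _ => Commute.one_left _) (by simp [h3]))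
    (fun w w' hw => end_ext_of_commute h (fun t ht => (h1 w t ht).mul_left (h1 w' t ht)) (h1 _)
      (by rw [Module.End.mul_apply, h3, h3, h2 w w' hw]))
    (fun s hs => end_ext_of_commute h (fun t ht => (Commute.sub_left (R := Module.End ℤ[Γ] (W →₀ ℤ[Γ])) (h1 s t ht) (h4 _ t)).mul_left
      ((h1 s t ht).add_left (h4 _ t))) (fun t _ => Commute.zero_left _) ?_), fun w => by
        rw [heckeLift_T, h3]⟩
  have h5 : f s = leftOp S φ s := by
    refine end_ext_of_commute h (h1 s) (fun t ht => leftOp_commute_rightOp h hφ hs ht) ?_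
    rw [h3, leftOp_single_of_lt, mul_one]
    rw [mul_one, wordLength_one, h.wordLength_simple hs]
    exact one_pos
  have h6 : leftOp S φ s (Finsupp.single s 1) =
      Finsupp.single 1 1 + xi φ s • Finsupp.single s 1 := by
    rw [leftOp_single, h.mul_self s hs, if_pos]
    rw [wordLength_one, h.wordLength_simple hs]
    exact one_pos
  have h7 := expo_mul_neg (φ s)
  simp only [Module.End.mul_apply, LinearMap.add_apply, LinearMap.sub_apply, h3, map_add,
    Module.algebraMap_end_apply, map_smul, LinearMap.zero_apply]
  rw [h5, h6, xi, smul_sub, smul_smul, mul_comm (expo (-φ s)), h7]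
  module

end RegularRepresentation

theorem linearIndependent_T (h : HalfSystem S P) (hφ : IsWeightFunction S φ) :
    LinearIndependent ℤ[Γ] (T S φ) := by
  obtain ⟨ρ, hρ⟩ := exists_regularRepresentation h hφ
  have h1 : LinearIndependent ℤ[Γ] fun w : W => (Finsupp.single w 1 : W →₀ ℤ[Γ]) :=
    Finsupp.linearIndependent_single_one _ _
  refine LinearIndependent.of_comp
    ((LinearMap.applyₗ (Finsupp.single (1 : W) (1 : ℤ[Γ]))).comp ρ.toLinearMap) ?_
  convert h1 using 2 with w
  exact hρ w

/-- The basis `(T_w)` of the Hecke algebra. -/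
def basisT (h : HalfSystem S P) (hφ : IsWeightFunction S φ) :
    Module.Basis W ℤ[Γ] (Hecke S φ) :=
  Module.Basis.mk (linearIndependent_T h hφ) (span_T h).ge

theorem basisT_apply (h : HalfSystem S P) (hφ : IsWeightFunction S φ) (w : W) :
    basisT h hφ w = T S φ w :=
  Module.Basis.mk_apply _ _ _

end

end KL

namespace KL

noncomputable section

/-! ### Bar and negative parts in the group algebra of `Γ`. -/

section GroupAlgebra

variable {Γ : Type*} [AddCommGroup Γ]

/-- The ring involution `e ^ γ ↦ e ^ (-γ)` of `ℤ[Γ]`. -/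
def barA : ℤ[Γ] →+* ℤ[Γ] :=
  (AddMonoidAlgebra.mapDomainRingEquiv ℤ (AddEquiv.neg Γ) : ℤ[Γ] ≃+* ℤ[Γ])

theorem coeff_barA (a : ℤ[Γ]) (γ : Γ) : (barA a).coeff γ = a.coeff (-γ) := by
  simp only [barA, RingEquiv.coe_toRingHom, AddMonoidAlgebra.coeff_mapDomainRingEquiv,
    Finsupp.equivMapDomain_apply]
  rfl

theorem ringHom_ext_expo {R : Type*} [Ring R] {f g : ℤ[Γ] →+* R}
    (h : ∀ γ, f (expo γ) = g (expo γ)) : f = g := by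
  refine AddMonoidAlgebra.ringHom_ext (fun r => ?_) h
  exact congrArg (fun F : ℤ →+* R => F r) (RingHom.ext_int
    (f.comp (AddMonoidAlgebra.singleZeroRingHom : ℤ →+* ℤ[Γ]))
    (g.comp (AddMonoidAlgebra.singleZeroRingHom : ℤ →+* ℤ[Γ])))

theorem barA_expo (γ : Γ) : barA (expo γ) = expo (-γ) := by
  classical
  ext δ
  simp only [coeff_barA, expo, AddMonoidAlgebra.coeff_single, Finsupp.single_apply, neg_eq_iff_eq_neg,
    eq_neg_iff_add_eq_zero, add_comm γ]

theorem coeff_natCast_mul (n : ℕ) (a : ℤ[Γ]) (γ : Γ) :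
    ((n : ℤ[Γ]) * a).coeff γ = n * a.coeff γ := by
  rw [← nsmul_eq_mul, AddMonoidAlgebra.coeff_smul_apply, nsmul_eq_mul]

theorem natCast_dvd_of_coeff {n : ℕ} {a : ℤ[Γ]} (h : ∀ γ, (n : ℤ) ∣ a.coeff γ) :
    (n : ℤ[Γ]) ∣ a := by
  refine ⟨.ofCoeff (a.coeff.mapRange (· / (n : ℤ)) (by simp)), ?_⟩
  ext γ
  rw [coeff_natCast_mul, AddMonoidAlgebra.coeff_ofCoeff, Finsupp.mapRange_apply]
  exact (Int.mul_ediv_cancel' (h γ)).symm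

variable [LinearOrder Γ]

/-- The projection of `ℤ[Γ]` onto `⊕_{γ < 0} ℤ e ^ γ`. -/
def negTrunc (a : ℤ[Γ]) : ℤ[Γ] := .ofCoeff (a.coeff.filter (· < 0))

theorem coeff_negTrunc (a : ℤ[Γ]) (γ : Γ) :
    (negTrunc a).coeff γ = if γ < 0 then a.coeff γ else 0 :=
  Finsupp.filter_apply _ _ _

variable [IsOrderedAddMonoid Γ]

/-- Antisymmetry determines the positive part from the negative one, and makes the constant
coefficient its own opposite, hence zero in `ℤ`. -/
theorem negTrunc_sub_barA {a : ℤ[Γ]} (h : barA a = -a) :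
    negTrunc a - barA (negTrunc a) = a := by
  ext γ
  have h1 : a.coeff (-γ) = - a.coeff γ := by rw [← coeff_barA, h]; simp
  simp only [AddMonoidAlgebra.coeff_sub, Finsupp.sub_apply, coeff_barA, coeff_negTrunc,
    Left.neg_neg_iff, h1]
  rcases lt_trichotomy γ 0 with h2 | rfl | h2
  · simp [h2, h2.not_gt]
  · rw [neg_zero] at h1
    simp
    lia
  · simp [h2, h2.not_gt]

/-- The supports of `a` and `barA a` are disjoint, so nothing cancels in the difference. -/
theorem natCast_dvd_of_dvd_barA_sub {n : ℕ} {a : ℤ[Γ]} (ha : ∀ γ, a.coeff γ ≠ 0 → γ < 0)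
    (h : (n : ℤ[Γ]) ∣ barA a - a) : (n : ℤ[Γ]) ∣ a := by
  obtain ⟨c, hc⟩ := h
  refine natCast_dvd_of_coeff fun γ => ?_
  by_cases h0 : a.coeff γ = 0
  · simp [h0]
  have h1 : a.coeff (-γ) = 0 := by
    by_contra h1
    have := ha _ h1
    rw [Left.neg_neg_iff] at this
    exact lt_asymm this (ha _ h0)
  have h2 := congrArg (fun x => x.coeff γ) hc
  simp only [AddMonoidAlgebra.coeff_sub, Finsupp.sub_apply, coeff_barA, h1,
    coeff_natCast_mul] at h2
  exact ⟨-c.coeff γ, by linarith⟩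

end GroupAlgebra

variable {W : Type*} [Group W] {Γ : Type*} [AddCommGroup Γ]
  {S : Set W} {φ : W → Γ} {P : W → W → Prop}

/-! ### The bar involution of the Hecke algebra. -/

section Bar

theorem hecke_ringHom_ext {R : Type*} [Ring R] {f g : Hecke S φ →+* R}
    (h1 : ∀ γ, f (algebraMap ℤ[Γ] _ (expo γ)) = g (algebraMap ℤ[Γ] _ (expo γ)))
    (h2 : ∀ w, f (T S φ w) = g (T S φ w)) : f = g := by
  have h3 : f.comp (algebraMap ℤ[Γ] _) = g.comp (algebraMap ℤ[Γ] _) := ringHom_ext_expo h1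
  ext x
  have hx : x ∈ Algebra.adjoin ℤ[Γ] (Set.range (T S φ)) := by rw [adjoin_T]; trivial
  induction hx using Algebra.adjoin_induction with
  | mem x hx => obtain ⟨w, rfl⟩ := hx; exact h2 w
  | algebraMap a => exact congrArg (fun F : ℤ[Γ] →+* R => F a) h3
  | add x y _ _ hx hy => rw [map_add, map_add, hx, hy]
  | mul x y _ _ hx hy => rw [map_mul, map_mul, hx, hy]

theorem T_simple_mul_sub {s : W} (hs : s ∈ S) :
    T S φ s * (T S φ s - algebraMap ℤ[Γ] _ (xi φ s)) = 1 := by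
  rw [mul_sub, T_mul_self hs, Algebra.smul_def, Algebra.commutes, add_sub_cancel_right]

theorem sub_mul_T_simple {s : W} (hs : s ∈ S) :
    (T S φ s - algebraMap ℤ[Γ] _ (xi φ s)) * T S φ s = 1 := by
  rw [sub_mul, T_mul_self hs, Algebra.smul_def, add_sub_cancel_right]

theorem T_simple_mul_of_lt (h : HalfSystem S P) {s c : W} (hs : s ∈ S)
    (hc : wordLength S (s * c) = wordLength S c + 1) : T S φ s * T S φ c = T S φ (s * c) :=
  T_mul s c (by rw [hc, h.wordLength_simple hs, add_comm])

theorem isUnit_T (h : HalfSystem S P) (w : W) : IsUnit (T S φ w) := by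
  induction w using h.induction with
  | one => rw [T_one]; exact isUnit_one
  | mul s hs c h1 ih =>
    rw [← T_simple_mul_of_lt h hs h1]
    exact IsUnit.mul ⟨⟨_, _, T_simple_mul_sub hs, sub_mul_T_simple hs⟩, rfl⟩ ih

/-- The Hecke algebra, with the structure of `ℤ[Γ]`-algebra twisted by `barA`. -/
def BarHecke (S : Set W) (φ : W → Γ) : Type _ := Hecke S φ

instance (S : Set W) (φ : W → Γ) : Ring (BarHecke S φ) := inferInstanceAs (Ring (Hecke S φ))

instance (S : Set W) (φ : W → Γ) : Algebra ℤ[Γ] (BarHecke S φ) :=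
  RingHom.toAlgebra' ((algebraMap ℤ[Γ] (Hecke S φ)).comp barA)
    fun a x => Algebra.commutes (A := Hecke S φ) (barA a) x

theorem algebraMap_barHecke (a : ℤ[Γ]) :
    algebraMap ℤ[Γ] (BarHecke S φ) a = algebraMap ℤ[Γ] (Hecke S φ) (barA a) := rfl

theorem exists_isBar (h : HalfSystem S P) : ∃ β, IsBar S φ β := by
  choose u hu using fun w => isUnit_T (φ := φ) h w
  have h1 : ∀ s ∈ S, ((u s)⁻¹ : (Hecke S φ)ˣ).val = T S φ s - algebraMap ℤ[Γ] _ (xi φ s) :=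
    fun s hs => Units.inv_eq_of_mul_eq_one_right (by rw [hu]; exact T_simple_mul_sub hs)
  have hmul : ∀ w w', wordLength S (w * w') = wordLength S w + wordLength S w' →
      ((u w⁻¹)⁻¹ : (Hecke S φ)ˣ).val * ((u w'⁻¹)⁻¹ : (Hecke S φ)ˣ).val =
        ((u (w * w')⁻¹)⁻¹ : (Hecke S φ)ˣ).val := by
    intro w w' hw
    have : u (w * w')⁻¹ = u w'⁻¹ * u w⁻¹ := Units.ext (by
      rw [Units.val_mul, hu, hu, hu, mul_inv_rev, T_mul]
      rw [← mul_inv_rev, h.wordLength_inv, h.wordLength_inv, h.wordLength_inv, hw, add_comm])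
    rw [this, mul_inv_rev, Units.val_mul]
  have hquad : ∀ s ∈ S,
      (((u s⁻¹)⁻¹ : (Hecke S φ)ˣ).val - algebraMap ℤ[Γ] _ (expo (-φ s))) *
        (((u s⁻¹)⁻¹ : (Hecke S φ)ˣ).val + algebraMap ℤ[Γ] _ (expo (φ s))) = 0 := by
    intro s hs
    rw [h.inv_eq hs, h1 s hs, xi, map_sub, ← T_quadratic (φ := φ) hs]
    congr 1 <;> abel
  -- Twisting the scalars of the target turns the semilinear bar map into an algebra homomorphism,
  -- so the universal property applies.
  let β : Hecke S φ →ₐ[ℤ[Γ]] BarHecke S φ := heckeLift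
    (fun w => (((u w⁻¹)⁻¹ : (Hecke S φ)ˣ).val : Hecke S φ))
    (by
      have : u 1⁻¹ = 1 := Units.ext (by rw [hu, inv_one, T_one]; rfl)
      simp only [this]
      rfl)
    hmul
    (fun s hs => by
      simp only [algebraMap_barHecke, barA_expo, neg_neg]
      exact hquad s hs)
  let β' : Hecke S φ →+* Hecke S φ := β.toRingHom
  refine ⟨β', fun γ => ?_, fun w => ?_⟩
  · have := β.commutes (expo γ)
    rw [algebraMap_barHecke, barA_expo] at this
    exact this
  · have h2 : β (T S φ w) = ((u w⁻¹)⁻¹ : (Hecke S φ)ˣ).val := heckeLift_T _ _ _ _ w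
    have h3 : β' (T S φ w) = ((u w⁻¹)⁻¹ : (Hecke S φ)ˣ).val := h2
    rw [h3, ← hu w⁻¹]
    exact ⟨Units.inv_mul _, Units.mul_inv _⟩

theorem IsBar.eq {β β' : Hecke S φ →+* Hecke S φ} (h : IsBar S φ β) (h' : IsBar S φ β') :
    β = β' :=
  hecke_ringHom_ext (fun γ => by rw [h.1, h'.1])
    fun w => left_inv_eq_right_inv (h.2 w).1 (h'.2 w).2

theorem isBar_bar (h : HalfSystem S P) : IsBar S φ (bar S φ) :=
  Classical.epsilon_spec (exists_isBar h)

theorem bar_algebraMap (h : HalfSystem S P) (a : ℤ[Γ]) :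
    bar S φ (algebraMap ℤ[Γ] _ a) = algebraMap ℤ[Γ] _ (barA a) := by
  have h1 : (bar S φ).comp (algebraMap ℤ[Γ] _) = (algebraMap ℤ[Γ] _).comp barA := by
    refine ringHom_ext_expo fun γ => ?_
    rw [RingHom.comp_apply, RingHom.comp_apply, barA_expo, (isBar_bar h).1]
  exact congrArg (fun F : ℤ[Γ] →+* Hecke S φ => F a) h1

theorem bar_smul (h : HalfSystem S P) (a : ℤ[Γ]) (x : Hecke S φ) :
    bar S φ (a • x) = barA a • bar S φ x := by
  rw [Algebra.smul_def, map_mul, bar_algebraMap h, Algebra.smul_def]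

theorem bar_bar (h : HalfSystem S P) (x : Hecke S φ) : bar S φ (bar S φ x) = x := by
  have hb := isBar_bar (φ := φ) h
  have h1 : (bar S φ).comp (bar S φ) = RingHom.id _ := by
    refine hecke_ringHom_ext (fun γ => ?_) fun w => ?_
    · simp only [RingHom.comp_apply, hb.1, neg_neg, RingHom.id_apply]
    · have h2 := congrArg (bar S φ) (hb.2 w).1
      have h3 := (hb.2 w⁻¹).2
      rw [map_mul, map_one] at h2
      rw [inv_inv] at h3
      have h4 := (hb.2 w⁻¹).1
      rw [inv_inv] at h4
      exact left_inv_eq_right_inv h2 h4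
  exact congrArg (fun F : Hecke S φ →+* Hecke S φ => F x) h1

theorem bar_T_simple (h : HalfSystem S P) {s : W} (hs : s ∈ S) :
    bar S φ (T S φ s) = T S φ s - algebraMap ℤ[Γ] _ (xi φ s) := by
  have := ((isBar_bar (φ := φ) h).2 s).1
  rw [h.inv_eq hs] at this
  exact left_inv_eq_right_inv this (T_simple_mul_sub hs)

end Bar

/-! ### The length filtration and unitriangularity of bar. -/

section Filtration

/-- The span of the elements `T_w` with `w` of length less than `n`. -/
def filt (S : Set W) (φ : W → Γ) (n : ℕ) : Submodule ℤ[Γ] (Hecke S φ) :=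
  Submodule.span ℤ[Γ] (T S φ '' {w | wordLength S w < n})

theorem T_mem_filt {w : W} {n : ℕ} (hw : wordLength S w < n) : T S φ w ∈ filt S φ n :=
  Submodule.subset_span ⟨w, hw, rfl⟩

theorem filt_mono {m n : ℕ} (hmn : m ≤ n) : filt S φ m ≤ filt S φ n :=
  Submodule.span_mono (Set.image_mono fun _ hw => lt_of_lt_of_le hw hmn)

theorem repr_eq_zero_of_mem_filt (h : HalfSystem S P) (hφ : IsWeightFunction S φ) {n : ℕ}
    {x : Hecke S φ} (hx : x ∈ filt S φ n) {w : W} (hw : n ≤ wordLength S w) :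
    (basisT h hφ).repr x w = 0 := by
  classical
  induction hx using Submodule.span_induction with
  | mem x hx =>
    obtain ⟨v, hv, rfl⟩ := hx
    rw [← basisT_apply h hφ, Module.Basis.repr_self_apply, if_neg]
    rintro rfl
    exact absurd hv hw.not_gt
  | zero => simp
  | add x y _ _ hx hy => simp [hx, hy]
  | smul a x _ hx => simp [hx]

theorem eq_sum_repr (h : HalfSystem S P) (hφ : IsWeightFunction S φ) (x : Hecke S φ) :
    x = ((basisT h hφ).repr x).sum fun w a => a • T S φ w := by
  conv_lhs => rw [← (basisT h hφ).linearCombination_repr x, Finsupp.linearCombination_apply]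
  simp only [basisT_apply]

theorem mem_of_repr (h : HalfSystem S P) (hφ : IsWeightFunction S φ)
    {V : AddSubgroup (Hecke S φ)} {x : Hecke S φ}
    (hx : ∀ w, (basisT h hφ).repr x w • T S φ w ∈ V) : x ∈ V := by
  rw [eq_sum_repr h hφ x]
  exact sum_mem fun w _ => hx w

theorem mem_filt_of_repr (h : HalfSystem S P) (hφ : IsWeightFunction S φ) {n : ℕ}
    {x : Hecke S φ} (hx : ∀ w, n ≤ wordLength S w → (basisT h hφ).repr x w = 0) :
    x ∈ filt S φ n := by
  refine mem_of_repr h hφ (V := (filt S φ n).toAddSubgroup) fun w => ?_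
  by_cases hw : n ≤ wordLength S w
  · rw [hx w hw, zero_smul]
    exact zero_mem _
  · exact (filt S φ n).smul_mem _ (T_mem_filt (not_le.1 hw))

theorem exists_mem_filt (h : HalfSystem S P) (hφ : IsWeightFunction S φ) (x : Hecke S φ) :
    ∃ n, x ∈ filt S φ n := by
  refine ⟨((basisT h hφ).repr x).support.sup (wordLength S) + 1, mem_filt_of_repr h hφ ?_⟩
  intro w hw
  by_contra h1
  have := Finset.le_sup (f := wordLength S) (Finsupp.mem_support_iff.2 h1)
  lia

theorem T_simple_mul_mem_filt (h : HalfSystem S P) {s : W} (hs : s ∈ S) {n : ℕ}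
    {x : Hecke S φ} (hx : x ∈ filt S φ n) : T S φ s * x ∈ filt S φ (n + 1) := by
  induction hx using Submodule.span_induction with
  | mem x hx =>
    obtain ⟨v, hv, rfl⟩ := hx
    have hv : wordLength S v < n := hv
    have h2 := h.wordLength_simple_mul hs v
    rcases T_simple_mul (φ := φ) h hs v with h1 | ⟨-, h1⟩
    · exact h1 ▸ T_mem_filt (by lia)
    · exact h1 ▸ add_mem (T_mem_filt (by lia)) (Submodule.smul_mem _ _ (T_mem_filt (by lia)))
  | zero => simp
  | add x y _ _ hx hy => rw [mul_add]; exact add_mem hx hy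
  | smul a x _ hx => rw [mul_smul_comm]; exact Submodule.smul_mem _ _ hx

theorem bar_T_sub_mem_filt (h : HalfSystem S P) (w : W) :
    bar S φ (T S φ w) - T S φ w ∈ filt S φ (wordLength S w) := by
  induction w using h.induction with
  | one => simp [T_one]
  | mul s hs c h1 ih =>
    rw [← T_simple_mul_of_lt h hs h1, map_mul, bar_T_simple h hs, h1]
    set r := bar S φ (T S φ c) - T S φ c with hr
    have e : (T S φ s - algebraMap ℤ[Γ] _ (xi φ s)) * bar S φ (T S φ c) - T S φ s * T S φ c =
        T S φ s * r - xi φ s • T S φ c - xi φ s • r := by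
      rw [hr, Algebra.smul_def, Algebra.smul_def]
      noncomm_ring
    rw [e]
    exact sub_mem (sub_mem (T_simple_mul_mem_filt h hs ih)
      (Submodule.smul_mem _ _ (T_mem_filt (Nat.lt_succ_self _))))
      (Submodule.smul_mem _ _ (filt_mono (Nat.le_succ _) ih))

theorem bar_mem_filt (h : HalfSystem S P) {n : ℕ} {x : Hecke S φ} (hx : x ∈ filt S φ n) :
    bar S φ x ∈ filt S φ n := by
  induction hx using Submodule.span_induction with
  | mem x hx =>
    obtain ⟨v, hv, rfl⟩ := hx
    rw [← sub_add_cancel (bar S φ (T S φ v)) (T S φ v)]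
    exact add_mem (filt_mono (le_of_lt hv) (bar_T_sub_mem_filt h v)) (T_mem_filt hv)
  | zero => simp
  | add x y _ _ hx hy => rw [map_add]; exact add_mem hx hy
  | smul a x _ hx => rw [bar_smul h]; exact Submodule.smul_mem _ _ hx

/-- Bar changes `T_v` only by terms shorter than `v`, so at top length it just conjugates
coefficients. -/
theorem repr_bar_of_mem_filt (h : HalfSystem S P) (hφ : IsWeightFunction S φ)
    {x : Hecke S φ} {w : W} (hx : x ∈ filt S φ (wordLength S w + 1)) :
    (basisT h hφ).repr (bar S φ x) w = barA ((basisT h hφ).repr x w) := by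
  classical
  induction hx using Submodule.span_induction with
  | mem x hx =>
    obtain ⟨v, hv, rfl⟩ := hx
    have h1 := repr_eq_zero_of_mem_filt h hφ (bar_T_sub_mem_filt h v) (w := w)
      (Nat.lt_succ_iff.1 hv)
    rw [map_sub, Finsupp.sub_apply, sub_eq_zero] at h1
    rw [h1, ← basisT_apply h hφ, Module.Basis.repr_self_apply]
    split_ifs <;> simp
  | zero => simp
  | add x y _ _ hx hy => simp [hx, hy]
  | smul a x _ hx => simp [bar_smul h, hx]

end Filtration

/-! ### Existence, uniqueness and basis property of the Kazhdan–Lusztig elements. -/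

section KazhdanLusztig

variable [LinearOrder Γ]

theorem smul_T_mem_negPart {a : ℤ[Γ]} (ha : ∀ γ, a.coeff γ ≠ 0 → γ < 0) (w : W) :
    a • T S φ w ∈ negPart S φ := by
  rw [← AddMonoidAlgebra.sum_coeff_single a, Finsupp.sum, Finset.sum_smul]
  refine sum_mem fun γ hγ => ?_
  have : AddMonoidAlgebra.single γ (a.coeff γ) = a.coeff γ • expo γ := by
    rw [expo, AddMonoidAlgebra.smul_single, smul_eq_mul, mul_one]
  rw [this, smul_assoc]
  have hmem : expo γ • T S φ w ∈ negPart S φ :=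
    AddSubgroup.subset_closure ⟨γ, ha γ (Finsupp.mem_support_iff.1 hγ), w, rfl⟩
  exact zsmul_mem hmem _

theorem mem_negPart_of_repr (h : HalfSystem S P) (hφ : IsWeightFunction S φ) {x : Hecke S φ}
    (hx : ∀ w γ, ((basisT h hφ).repr x w).coeff γ ≠ 0 → γ < 0) : x ∈ negPart S φ :=
  mem_of_repr h hφ fun w => smul_T_mem_negPart (hx w) w

theorem neg_of_mem_negPart (h : HalfSystem S P) (hφ : IsWeightFunction S φ) {x : Hecke S φ}
    (hx : x ∈ negPart S φ) (w : W) {γ : Γ} (hγ : ((basisT h hφ).repr x w).coeff γ ≠ 0) :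
    γ < 0 := by
  classical
  contrapose! hγ
  induction hx using AddSubgroup.closure_induction with
  | mem x hx =>
    obtain ⟨δ, hδ, v, rfl⟩ := hx
    rw [map_smul, ← basisT_apply h hφ, Finsupp.smul_apply, Module.Basis.repr_self_apply]
    have : δ ≠ γ := (lt_of_lt_of_le hδ hγ).ne
    split_ifs <;> simp [expo, AddMonoidAlgebra.coeff_single, this]
  | zero => simp
  | add x y _ _ hx hy => simp [hx, hy]
  | neg x _ hx => simp [hx]

variable [IsOrderedAddMonoid Γ]

/-- Modulo `n`, lower the length filtration step by step: a top coefficient lies in `A_{<0}` and is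
bar-invariant modulo `n`, hence divisible by `n`. The case `n = 0` is the uniqueness of `C_w`; `n =
p` compares `C_z` with `C^G_z`. -/
theorem exists_nsmul_of_bar_sub (h : HalfSystem S P) (hφ : IsWeightFunction S φ) {n : ℕ}
    {x k : Hecke S φ} (hx : x ∈ negPart S φ) (hk : bar S φ x - x = (n : ℤ[Γ]) • k) :
    ∃ y, x = (n : ℤ[Γ]) • y := by
  set V : Submodule ℤ[Γ] (Hecke S φ) := LinearMap.range (LinearMap.lsmul _ _ (n : ℤ[Γ])) with hV
  have hVmem : ∀ y, (n : ℤ[Γ]) • y ∈ V := fun y => ⟨y, rfl⟩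
  obtain ⟨N, hN⟩ := exists_mem_filt h hφ x
  have key : ∀ N, x ∈ filt S φ N ⊔ V → x ∈ V := by
    intro N
    induction N with
    | zero =>
      have : filt S φ 0 = ⊥ := by simp [filt]
      rw [this, bot_sup_eq]
      exact id
    | succ N ih =>
      intro h1
      refine ih ?_
      obtain ⟨f, hf, _, ⟨y, rfl⟩, h2⟩ := Submodule.mem_sup.1 h1
      rw [LinearMap.lsmul_apply] at h2
      have hdvd : ∀ w, wordLength S w = N → (n : ℤ[Γ]) ∣ (basisT h hφ).repr f w := by
        rintro w rfl
        have e0 : (basisT h hφ).repr x w =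
            (basisT h hφ).repr f w + n * (basisT h hφ).repr y w := by
          rw [← h2, map_add, map_smul, Finsupp.add_apply, Finsupp.smul_apply, smul_eq_mul]
        have e1 := congrArg (fun z => (basisT h hφ).repr z w) hk
        simp only [← h2, map_add, bar_smul h, map_sub, map_smul, Finsupp.add_apply,
          Finsupp.sub_apply, Finsupp.smul_apply, repr_bar_of_mem_filt h hφ hf, smul_eq_mul,
          map_natCast] at e1
        have e2 : (n : ℤ[Γ]) ∣ (basisT h hφ).repr x w := by
          refine natCast_dvd_of_dvd_barA_sub (fun γ => neg_of_mem_negPart h hφ hx w) ?_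
          rw [e0, map_add, map_mul, map_natCast]
          refine ⟨(basisT h hφ).repr k w - (basisT h hφ).repr (bar S φ y) w +
            barA ((basisT h hφ).repr y w), ?_⟩
          linear_combination e1
        rw [e0] at e2
        exact (dvd_add_left (dvd_mul_right _ _)).1 e2
      rw [← h2]
      refine add_mem ?_ (Submodule.mem_sup_right (hVmem y))
      refine mem_of_repr h hφ (V := (filt S φ N ⊔ V).toAddSubgroup) fun w => ?_
      rcases lt_trichotomy (wordLength S w) N with h3 | h3 | h3
      · exact Submodule.mem_sup_left (Submodule.smul_mem _ _ (T_mem_filt h3))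
      · obtain ⟨a, ha⟩ := hdvd w h3
        rw [ha, mul_smul]
        exact Submodule.mem_sup_right (hVmem _)
      · rw [repr_eq_zero_of_mem_filt h hφ hf h3, zero_smul]
        exact zero_mem _
  obtain ⟨y, hy⟩ := key N (Submodule.mem_sup_left hN)
  exact ⟨y, hy.symm⟩

theorem eq_zero_of_bar_eq (h : HalfSystem S P) (hφ : IsWeightFunction S φ)
    {x : Hecke S φ} (hx : x ∈ negPart S φ) (hb : bar S φ x = x) : x = 0 := by
  obtain ⟨y, hy⟩ := exists_nsmul_of_bar_sub h hφ (n := 0) (k := 0) hx (by simp [hb])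
  simpa using hy

/-- The negative truncation of all coefficients solves the equation at top length; the error is
again anti-invariant and lies one step lower. Taking `d` to be bar of `T_w` minus `T_w` produces
`C_w` as `T_w + b`. -/
theorem exists_sub_bar_eq (h : HalfSystem S P) (hφ : IsWeightFunction S φ) (N : ℕ) :
    ∀ d ∈ filt S φ N, bar S φ d = -d →
      ∃ b ∈ filt S φ N, b ∈ negPart S φ ∧ b - bar S φ b = d := by
  induction N with
  | zero =>
    intro d hd _
    have : filt S φ 0 = ⊥ := by simp [filt]
    rw [this, Submodule.mem_bot] at hd
    exact ⟨0, zero_mem _, zero_mem _, by simp [hd]⟩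
  | succ N ih =>
    intro d hd hbd
    set b₁ : Hecke S φ := (basisT h hφ).repr.symm
      (((basisT h hφ).repr d).mapRange negTrunc (by ext; simp [coeff_negTrunc])) with hb₁
    have hr : ∀ w, (basisT h hφ).repr b₁ w = negTrunc ((basisT h hφ).repr d w) := by
      intro w
      rw [hb₁, LinearEquiv.apply_symm_apply, Finsupp.mapRange_apply]
    have h1 : b₁ ∈ filt S φ (N + 1) := mem_filt_of_repr h hφ fun w hw => by
      rw [hr, repr_eq_zero_of_mem_filt h hφ hd hw]
      ext; simp [coeff_negTrunc]
    have h2 : b₁ ∈ negPart S φ := mem_negPart_of_repr h hφ fun w γ => by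
      rw [hr, coeff_negTrunc]
      split_ifs with h3 <;> simp [h3]
    have h3 : d - (b₁ - bar S φ b₁) ∈ filt S φ N := by
      refine mem_filt_of_repr h hφ fun w hw => ?_
      rcases hw.lt_or_eq with hw | rfl
      · exact repr_eq_zero_of_mem_filt h hφ (sub_mem hd (sub_mem h1 (bar_mem_filt h h1))) hw
      · have h4 : barA ((basisT h hφ).repr d w) = -(basisT h hφ).repr d w := by
          rw [← repr_bar_of_mem_filt h hφ hd, hbd, map_neg, Finsupp.neg_apply]
        rw [map_sub, map_sub, Finsupp.sub_apply, Finsupp.sub_apply,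
          repr_bar_of_mem_filt h hφ h1, hr, negTrunc_sub_barA h4, sub_self]
    obtain ⟨b₂, h5, h6, h7⟩ := ih _ h3 (by rw [map_sub, map_sub, bar_bar h, hbd]; abel)
    refine ⟨b₁ + b₂, add_mem h1 (filt_mono (Nat.le_succ _) h5), add_mem h2 h6, ?_⟩
    rw [map_add, add_sub_add_comm, h7]
    abel

theorem IsKLElement.eq (h : HalfSystem S P) (hφ : IsWeightFunction S φ) {w : W}
    {c c' : Hecke S φ} (hc : IsKLElement S φ w c) (hc' : IsKLElement S φ w c') : c = c' := by
  rw [← sub_eq_zero]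
  refine eq_zero_of_bar_eq h hφ ?_ (by rw [map_sub, hc.1, hc'.1])
  rw [← sub_sub_sub_cancel_right c c' (T S φ w)]
  exact sub_mem hc.2 hc'.2

theorem exists_isKLElement (h : HalfSystem S P) (hφ : IsWeightFunction S φ) (w : W) :
    ∃ c, IsKLElement S φ w c ∧ c - T S φ w ∈ filt S φ (wordLength S w) := by
  obtain ⟨b, h1, h2, h3⟩ := exists_sub_bar_eq h hφ _ _ (bar_T_sub_mem_filt (φ := φ) h w)
    (by rw [map_sub, bar_bar h]; abel)
  refine ⟨T S φ w + b, ⟨?_, by simpa using h2⟩, by simpa using h1⟩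
  rw [map_add, ← sub_eq_sub_iff_add_eq_add.1 h3, add_comm]

theorem isKLElement_C (h : HalfSystem S P) (hφ : IsWeightFunction S φ) (w : W) :
    IsKLElement S φ w (C S φ w) :=
  Classical.epsilon_spec ((exists_isKLElement h hφ w).imp fun _ hc => hc.1)

theorem C_sub_T_mem_filt (h : HalfSystem S P) (hφ : IsWeightFunction S φ) (w : W) :
    C S φ w - T S φ w ∈ filt S φ (wordLength S w) := by
  obtain ⟨c, h1, h2⟩ := exists_isKLElement h hφ w
  rwa [(isKLElement_C h hφ w).eq h hφ h1]

theorem linearIndependent_C (h : HalfSystem S P) (hφ : IsWeightFunction S φ) :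
    LinearIndependent ℤ[Γ] (C S φ) := by
  classical
  rw [linearIndependent_iff]
  intro f hf
  by_contra h0
  obtain ⟨z, hz, hmax⟩ := Finset.exists_max_image f.support (wordLength S)
    (Finsupp.support_nonempty_iff.2 h0)
  have h1 := congrArg (fun x => (basisT h hφ).repr x z) hf
  simp only [Finsupp.linearCombination_apply, Finsupp.sum, map_sum, map_smul, map_zero,
    Finsupp.finsetSum_apply, Finsupp.smul_apply, Finsupp.zero_apply] at h1
  have h2 : ∀ v ∈ f.support, (basisT h hφ).repr (C S φ v) z = if v = z then 1 else 0 := by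
    intro v hv
    have h3 := repr_eq_zero_of_mem_filt h hφ (C_sub_T_mem_filt h hφ v) (hmax v hv)
    rw [map_sub, Finsupp.sub_apply, sub_eq_zero] at h3
    rw [h3, ← basisT_apply h hφ, Module.Basis.repr_self_apply]
  rw [Finset.sum_congr rfl fun v hv => by rw [h2 v hv]] at h1
  simp only [smul_eq_mul, mul_ite, mul_one, mul_zero, Finset.sum_ite_eq', if_pos hz] at h1
  exact Finsupp.mem_support_iff.1 hz h1

theorem span_C (h : HalfSystem S P) (hφ : IsWeightFunction S φ) :
    Submodule.span ℤ[Γ] (Set.range (C S φ)) = ⊤ := by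
  have key : ∀ n, filt S φ n ≤ Submodule.span ℤ[Γ] (Set.range (C S φ)) := by
    intro n
    induction n with
    | zero => simp [filt]
    | succ n ih =>
      rw [filt, Submodule.span_le]
      rintro _ ⟨v, hv, rfl⟩
      rw [← sub_sub_cancel (C S φ v) (T S φ v)]
      exact sub_mem (Submodule.subset_span ⟨v, rfl⟩)
        (ih (filt_mono (Nat.lt_succ_iff.1 hv) (C_sub_T_mem_filt h hφ v)))
  rw [eq_top_iff]
  intro x _
  obtain ⟨n, hn⟩ := exists_mem_filt h hφ x
  exact key n hn

/-- The Kazhdan-Lusztig basis. -/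
def basisC (h : HalfSystem S P) (hφ : IsWeightFunction S φ) :
    Module.Basis W ℤ[Γ] (Hecke S φ) :=
  Module.Basis.mk (linearIndependent_C h hφ) (span_C h hφ).ge

theorem basisC_apply (h : HalfSystem S P) (hφ : IsWeightFunction S φ) (w : W) :
    basisC h hφ w = C S φ w :=
  Module.Basis.mk_apply _ _ _

theorem isStructureFamily_iff (h : HalfSystem S P) (hφ : IsWeightFunction S φ) {x y : W}
    {f : W →₀ ℤ[Γ]} : IsStructureFamily S φ x y f ↔
      f = (basisC h hφ).repr (C S φ x * C S φ y) := by
  rw [← (basisC h hφ).repr.symm_apply_eq, Module.Basis.repr_symm_apply,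
    Finsupp.linearCombination_apply, IsStructureFamily, eq_comm]
  simp only [basisC_apply]

theorem structureConst_eq (h : HalfSystem S P) (hφ : IsWeightFunction S φ) (x y z : W) :
    structureConst S φ x y z = (basisC h hφ).repr (C S φ x * C S φ y) z := by
  have h1 : ∃ f, IsStructureFamily S φ x y f := ⟨_, (isStructureFamily_iff h hφ).2 rfl⟩
  have h2 := (isStructureFamily_iff h hφ).1 (Classical.epsilon_spec h1)
  exact congrArg (fun f : W →₀ ℤ[Γ] => f z) h2

end KazhdanLusztig

section Tau

open Classical in
theorem isTau_iff (h : HalfSystem S P) (hφ : IsWeightFunction S φ)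
    {t : Hecke S φ →ₗ[ℤ[Γ]] ℤ[Γ]} : IsTau S φ t ↔ t = (basisT h hφ).coord 1 := by
  constructor
  · intro ht
    refine (basisT h hφ).ext fun w => ?_
    rw [Module.Basis.coord_apply, Module.Basis.repr_self_apply, basisT_apply, ht w]
  · rintro rfl w
    rw [Module.Basis.coord_apply, ← basisT_apply h hφ, Module.Basis.repr_self_apply]

theorem tau_eq (h : HalfSystem S P) (hφ : IsWeightFunction S φ) :
    tau S φ = (basisT h hφ).coord 1 :=
  (isTau_iff h hφ).1 (Classical.epsilon_spec ⟨_, (isTau_iff h hφ).2 rfl⟩)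

end Tau

theorem wellDefined [LinearOrder Γ] [IsOrderedAddMonoid Γ] (h : HalfSystem S P)
    (hφ : IsWeightFunction S φ) : WellDefined S φ where
  linearIndependent_T := linearIndependent_T h hφ
  span_T := span_T h
  bar := ⟨bar S φ, isBar_bar h, fun _ hβ => hβ.eq (isBar_bar h)⟩
  tau := ⟨_, (isTau_iff h hφ).2 rfl, fun _ ht => (isTau_iff h hφ).1 ht⟩
  C w := ⟨C S φ w, isKLElement_C h hφ w, fun _ hc => hc.eq h hφ (isKLElement_C h hφ w)⟩
  structureConst _ _ := ⟨_, (isStructureFamily_iff h hφ).2 rfl,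
    fun _ hf => (isStructureFamily_iff h hφ).1 hf⟩

end

end KL

namespace KL

noncomputable section

/-! ### Orbit counting for a finite `p`-group. -/

section PGroup

theorem sum_eq_zero_of_isPGroup {p : ℕ} (hp : p.Prime) {G X M : Type*} [Group G] [Finite G]
    (hG : IsPGroup p G) [MulAction G X] [AddCommGroup M] (hM : ∀ m : M, p • m = 0)
    {s : Finset X} (hs : ∀ (σ : G), ∀ x ∈ s, σ • x ∈ s) {f : X → M}
    (hf : ∀ (σ : G) (x : X), f (σ • x) = f x)
    (h0 : ∀ x, (∀ σ : G, σ • x = x) → f x = 0) : ∑ x ∈ s, f x = 0 := by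
  classical
  have := Fact.mk hp
  refine Finset.sum_cancels_of_partition_cancels (MulAction.orbitRel G X) fun x hx => ?_
  have h1 : ∀ y ∈ s.filter fun y => MulAction.orbitRel G X y x, f y = f x := by
    intro y hy
    obtain ⟨σ, rfl⟩ := (Finset.mem_filter.1 hy).2
    exact hf σ x
  rw [Finset.sum_congr rfl h1, Finset.sum_const]
  have h2 : (s.filter fun y => MulAction.orbitRel G X y x).card =
      Nat.card (MulAction.orbit G x) := by
    rw [← Nat.card_eq_finsetCard]
    refine Nat.card_congr (Equiv.setCongr ?_)
    ext y
    simp only [Finset.coe_filter, Set.mem_ofPred_eq, MulAction.orbitRel_apply,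
      and_iff_right_iff_imp]
    rintro ⟨σ, rfl⟩
    exact hs σ x hx
  have hfin : Finite (MulAction.orbit G x) := Set.finite_range _
  obtain ⟨n, hn⟩ := hG.card_orbit x
  rw [h2, hn]
  rcases n with _ | n
  · rw [pow_zero] at hn
    have h3 : ∀ σ : G, σ • x = x := fun σ =>
      congrArg Subtype.val ((Nat.card_eq_one_iff_unique.1 hn).1.elim
        (⟨σ • x, σ, rfl⟩ : MulAction.orbit G x) ⟨x, MulAction.mem_orbit_self x⟩)
    rw [h0 x h3, smul_zero]
  · rw [pow_succ, mul_smul, hM, smul_zero]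

end PGroup

variable {W : Type*} [Group W] {Γ : Type*} [AddCommGroup Γ]
  {S : Set W} {φ : W → Γ} {P : W → W → Prop}

/-! ### The trace form, parabolic supports and the index character. -/

theorem repr_T_mul_T_one (h : HalfSystem S P) (hφ : IsWeightFunction S φ) (x y : W)
    [Decidable (x * y = 1)] :
    (basisT h hφ).repr (T S φ x * T S φ y) 1 = if x * y = 1 then 1 else 0 := by
  classical
  have h0 : ∀ y : W, (basisT h hφ).repr (T S φ y) 1 = if y = 1 then 1 else 0 := fun y => by
    rw [← basisT_apply h hφ, Module.Basis.repr_self_apply]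
  suffices H : ∀ y, (basisT h hφ).repr (T S φ x * T S φ y) 1 = if x * y = 1 then 1 else 0 by
    convert H y
  induction x using h.induction_right with
  | one => intro y; rw [T_one, one_mul, one_mul, h0]
  | mul s hs c h1 ih =>
    intro y
    have h2 : T S φ c * T S φ s = T S φ (c * s) :=
      T_mul _ _ (by rw [h1, h.wordLength_simple hs])
    rw [← h2, mul_assoc, mul_assoc]
    rcases T_simple_mul (φ := φ) h hs y with h3 | ⟨h3, h4⟩
    · rw [h3, ih]
    · rw [h4, mul_add, mul_smul_comm, map_add, map_smul, Finsupp.add_apply, Finsupp.smul_apply,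
        ih, ih, if_neg (c := c * y = 1), smul_zero, add_zero]
      -- If `c * y = 1` then `s * y` is the inverse of `c * s`, which is longer than `c`, whereas
      -- here `s` shortens `y`.
      intro h5
      rw [eq_inv_of_mul_eq_one_right h5, h.wordLength_inv, ← h.wordLength_inv, mul_inv_rev,
        inv_inv, h.inv_eq hs] at h3
      lia

theorem T_mul_mem_span_closure (h : HalfSystem S P) {I : Set W} (hI : I ⊆ S) {c : W}
    (hc : c ∈ Subgroup.closure I) :
    ∀ x ∈ Submodule.span ℤ[Γ] (T S φ '' (Subgroup.closure I : Set W)),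
      T S φ c * x ∈ Submodule.span ℤ[Γ] (T S φ '' (Subgroup.closure I : Set W)) := by
  have hT : ∀ c ∈ Subgroup.closure I,
      T S φ c ∈ Submodule.span ℤ[Γ] (T S φ '' (Subgroup.closure I : Set W)) :=
    fun c hc => Submodule.subset_span ⟨c, hc, rfl⟩
  refine h.parabolic_induction hI (p := fun c =>
    ∀ x ∈ Submodule.span ℤ[Γ] (T S φ '' (Subgroup.closure I : Set W)),
      T S φ c * x ∈ Submodule.span ℤ[Γ] (T S φ '' (Subgroup.closure I : Set W)))
    (by simp [T_one]) (fun s hs c _ hl ih x hx => ?_) hc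
  rw [← T_simple_mul_of_lt h (hI hs) hl, mul_assoc]
  have hy := ih x hx
  generalize T S φ c * x = y at hy
  induction hy using Submodule.span_induction with
  | mem x hx =>
    obtain ⟨v, hv, rfl⟩ := hx
    have hsv : s * v ∈ Subgroup.closure I := mul_mem (Subgroup.subset_closure hs) hv
    rcases T_simple_mul (φ := φ) h (hI hs) v with h1 | ⟨-, h1⟩
    · exact h1 ▸ hT _ hsv
    · exact h1 ▸ add_mem (hT _ hsv) (Submodule.smul_mem _ _ (hT _ hv))
  | zero => simp
  | add x y _ _ hx hy => rw [mul_add]; exact add_mem hx hy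
  | smul a x _ hx => rw [mul_smul_comm]; exact Submodule.smul_mem _ _ hx

theorem repr_T_mul_T_of_notMem (h : HalfSystem S P) (hφ : IsWeightFunction S φ) {I : Set W}
    (hI : I ⊆ S) {c c' w : W} (hc : c ∈ Subgroup.closure I) (hc' : c' ∈ Subgroup.closure I)
    (hw : w ∉ Subgroup.closure I) : (basisT h hφ).repr (T S φ c * T S φ c') w = 0 := by
  have h1 := T_mul_mem_span_closure (φ := φ) h hI hc _ (Submodule.subset_span ⟨c', hc', rfl⟩)
  have h2 : T S φ = basisT h hφ := funext fun w => (basisT_apply h hφ w).symm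
  rw [h2, Module.Basis.mem_span_image] at h1
  by_contra h3
  rw [h2] at h3
  exact hw (h1 (Finsupp.mem_support_iff.2 h3))

/-- The index character `T_w ↦ e ^ φ(w)` of the Hecke algebra. -/
def indexChar (hφ : IsWeightFunction S φ) : Hecke S φ →ₐ[ℤ[Γ]] ℤ[Γ] :=
  heckeLift (fun w => expo (φ w)) (by rw [hφ.one, expo_zero])
    (fun w w' hw => by rw [hφ w w' hw, expo_add]) (fun s _ => by simp)

theorem indexChar_T (hφ : IsWeightFunction S φ) (w : W) :
    indexChar hφ (T S φ w) = expo (φ w) :=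
  heckeLift_T _ _ _ _ _

/-- A finite `p`-group `G` of automorphisms of `W` that stabilises `S` and the weight function. -/
structure PGroupAction (p : ℕ) (S : Set W) (P : W → W → Prop) (φ : W → Γ)
    (G : Subgroup (MulAut W)) : Prop where
  half : HalfSystem S P
  weight : IsWeightFunction S φ
  prime : p.Prime
  finite : Finite G
  isPGroup : IsPGroup p G
  stable : ∀ σ ∈ G, (fun w => σ w) '' S = S
  weight_map : ∀ σ ∈ G, ∀ w, φ (σ w) = φ w

/-! ### The action of `G` on the Hecke algebra and its invariants. -/

namespace PGroupAction

variable {p : ℕ} {G : Subgroup (MulAut W)}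

theorem half_fixed (d : PGroupAction p S P φ G) : HalfSystem (fixedSimple S G)
    fun x w => wordLength S (w : W) < wordLength S (x * w : W) :=
  have := d.finite
  halfSystem_fixedSimple d.half d.stable

theorem weight_fixed (d : PGroupAction p S P φ G) :
    IsWeightFunction (fixedSimple S G) (fixedWeight φ G) :=
  have := d.finite
  isWeightFunction_fixedWeight d.half d.stable d.weight

theorem wordLength_mul (d : PGroupAction p S P φ G) (w w' : FixedPoints.subgroup G W)
    (hw : wordLength (fixedSimple S G) (w * w') =
      wordLength (fixedSimple S G) w + wordLength (fixedSimple S G) w') :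
    wordLength S (w * w' : W) = wordLength S (w : W) + wordLength S (w' : W) :=
  have := d.finite
  wordLength_mul_of_fixed d.half d.stable w w' hw

theorem wordLength_map (d : PGroupAction p S P φ G) (σ : G) (w : W) :
    wordLength S (σ • w) = wordLength S w :=
  wordLength_smul d.half d.stable σ w

/-- The basis `(T_w)` of the Hecke algebra of `W`. -/
abbrev basis (d : PGroupAction p S P φ G) : Module.Basis W ℤ[Γ] (Hecke S φ) :=
  basisT d.half d.weight

/-- The basis `(T_w)` of the Hecke algebra of `W ^ G`. -/
abbrev basisFixed (d : PGroupAction p S P φ G) : Module.Basis (FixedPoints.subgroup G W) ℤ[Γ]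
    (Hecke (fixedSimple S G) (fixedWeight φ G)) :=
  basisT d.half_fixed d.weight_fixed

/-- The action of `G` on the Hecke algebra. -/
def act (d : PGroupAction p S P φ G) (σ : G) : Hecke S φ →ₐ[ℤ[Γ]] Hecke S φ :=
  heckeLift (fun w => T S φ (σ • w)) (by rw [smul_one, T_one])
    (fun w w' hw => by
      rw [T_mul, smul_mul']
      rw [← smul_mul', d.wordLength_map, d.wordLength_map, d.wordLength_map, hw])
    (fun s hs => by
      have h1 : σ • s ∈ S := orbit_subset d.stable hs ⟨σ, rfl⟩
      have h2 : φ (σ • s) = φ s := d.weight_map σ σ.2 s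
      have h3 := T_quadratic (φ := φ) h1
      rwa [h2] at h3)

theorem act_T (d : PGroupAction p S P φ G) (σ : G) (w : W) :
    d.act σ (T S φ w) = T S φ (σ • w) :=
  heckeLift_T _ _ _ _ _

theorem act_basis (d : PGroupAction p S P φ G) (σ : G) (w : W) :
    d.act σ (d.basis w) = d.basis (σ • w) := by
  rw [basisT_apply, basisT_apply, act_T]

theorem repr_act (d : PGroupAction p S P φ G) {b : Module.Basis W ℤ[Γ] (Hecke S φ)}
    (hb : ∀ σ w, d.act σ (b w) = b (σ • w)) (σ : G) (x : Hecke S φ) (w : W) :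
    b.repr (d.act σ x) (σ • w) = b.repr x w := by
  classical
  have h1 : (b.coord (σ • w)).comp (d.act σ).toLinearMap = b.coord w := by
    refine b.ext fun v => ?_
    rw [LinearMap.comp_apply, AlgHom.toLinearMap_apply, hb, Module.Basis.coord_apply,
      Module.Basis.coord_apply, Module.Basis.repr_self_apply, Module.Basis.repr_self_apply]
    simp only [smul_left_cancel_iff]
  exact congrArg (fun F : Hecke S φ →ₗ[ℤ[Γ]] ℤ[Γ] => F x) h1

theorem act_bar (d : PGroupAction p S P φ G) (σ : G) (x : Hecke S φ) :
    d.act σ (bar S φ x) = bar S φ (d.act σ x) := by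
  have hb := isBar_bar (φ := φ) d.half
  have h1 : (d.act σ).toRingHom.comp (bar S φ) = (bar S φ).comp (d.act σ).toRingHom := by
    refine hecke_ringHom_ext (fun γ => ?_) fun w => ?_
    · simp only [AlgHom.toRingHom_eq_coe, RingHom.comp_apply, hb.1, RingHom.coe_coe,
        AlgHom.commutes]
    · have h2 := congrArg (d.act σ) (hb.2 w).1
      have h3 := (hb.2 (σ • w)).2
      rw [map_mul, map_one, act_T] at h2
      rw [← smul_inv'] at h3
      simp only [AlgHom.toRingHom_eq_coe, RingHom.comp_apply, RingHom.coe_coe, act_T]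
      exact left_inv_eq_right_inv h2 h3
  exact congrArg (fun F : Hecke S φ →+* Hecke S φ => F x) h1

/-- The `G`-invariant elements of the Hecke algebra. -/
def IsInvariant (d : PGroupAction p S P φ G) (x : Hecke S φ) : Prop :=
  ∀ σ : G, d.act σ x = x

theorem isInvariant_T (d : PGroupAction p S P φ G) (w : FixedPoints.subgroup G W) :
    d.IsInvariant (T S φ w) := fun σ => by
  rw [act_T, w.2 σ]

theorem IsInvariant.mul {d : PGroupAction p S P φ G} {x y : Hecke S φ} (hx : d.IsInvariant x)
    (hy : d.IsInvariant y) : d.IsInvariant (x * y) := fun σ => by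
  rw [map_mul, hx σ, hy σ]

theorem IsInvariant.bar {d : PGroupAction p S P φ G} {x : Hecke S φ} (hx : d.IsInvariant x) :
    d.IsInvariant (bar S φ x) := fun σ => by
  rw [act_bar, hx σ]

/-- The terms of `F x - F' x` are constant on orbits, so non-trivial orbits contribute multiples of
`p`. Any basis permuted by `G` will do; both the `T_w` and the `C_w` are used. -/
theorem eq_of_eq_on_fixed_basis (d : PGroupAction p S P φ G)
    {b : Module.Basis W ℤ[Γ] (Hecke S φ)} (hb : ∀ σ w, d.act σ (b w) = b (σ • w))
    {M : Type*} [AddCommGroup M] (hM : ∀ m : M, p • m = 0) {F F' : Hecke S φ → M}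
    (hadd : ∀ x y, F (x + y) = F x + F y) (hadd' : ∀ x y, F' (x + y) = F' x + F' y)
    (hact : ∀ σ x, F (d.act σ x) = F x) (hact' : ∀ σ x, F' (d.act σ x) = F' x)
    {x : Hecke S φ} (hx : d.IsInvariant x)
    (hfix : ∀ w : FixedPoints.subgroup G W,
      F (b.repr x w • b w) = F' (b.repr x w • b w)) : F x = F' x := by
  have := d.finite
  have hr : ∀ (σ : G) (w : W), b.repr x (σ • w) = b.repr x w := fun σ w => by
    conv_lhs => rw [← hx σ]
    exact d.repr_act hb σ x w
  let D : Hecke S φ →+ M := AddMonoidHom.mk' F hadd - AddMonoidHom.mk' F' hadd'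
  have hD : ∀ y, D y = F y - F' y := fun y => rfl
  rw [← sub_eq_zero, ← hD, ← b.linearCombination_repr x, Finsupp.linearCombination_apply,
    Finsupp.sum, map_sum]
  refine sum_eq_zero_of_isPGroup d.prime d.isPGroup hM (fun σ w hw => ?_) (fun σ w => ?_)
    fun w hw => ?_
  · rw [Finsupp.mem_support_iff] at hw ⊢
    rwa [hr]
  · rw [hr, ← hb, ← map_smul, hD, hD, hact, hact']
  · rw [hD, sub_eq_zero]
    exact hfix ⟨w, hw⟩

theorem eq_of_eq_on_fixed (d : PGroupAction p S P φ G) {M : Type*} [AddCommGroup M]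
    (hM : ∀ m : M, p • m = 0) {F F' : Hecke S φ → M}
    (hadd : ∀ x y, F (x + y) = F x + F y) (hadd' : ∀ x y, F' (x + y) = F' x + F' y)
    (hact : ∀ σ x, F (d.act σ x) = F x) (hact' : ∀ σ x, F' (d.act σ x) = F' x)
    {x : Hecke S φ} (hx : d.IsInvariant x)
    (hfix : ∀ w : FixedPoints.subgroup G W,
      F (d.basis.repr x w • T S φ w) = F' (d.basis.repr x w • T S φ w)) : F x = F' x :=
  d.eq_of_eq_on_fixed_basis d.act_basis hM hadd hadd' hact hact' hx fun w => by
    rw [basisT_apply]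
    exact hfix w

section Projection

variable (b : Module.Basis W ℤ[Γ] (Hecke S φ))
  (b' : Module.Basis (FixedPoints.subgroup G W) ℤ[Γ] (Hecke (fixedSimple S G) (fixedWeight φ G)))

open Classical in
/-- The projection onto the Hecke algebra of `W ^ G` that sends `b w` to `b' w` for `w ∈ W ^ G`
and to zero otherwise. -/
def fixedProj : Hecke S φ →ₗ[ℤ[Γ]] Hecke (fixedSimple S G) (fixedWeight φ G) :=
  b.constr ℤ[Γ] fun w => if hw : w ∈ FixedPoints.subgroup G W then b' ⟨w, hw⟩ else 0

theorem fixedProj_basis (w : FixedPoints.subgroup G W) : fixedProj b b' (b w) = b' w := by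
  rw [fixedProj, Module.Basis.constr_basis, dif_pos w.2]

theorem fixedProj_basis_of_notMem {w : W} (hw : w ∉ FixedPoints.subgroup G W) :
    fixedProj b b' (b w) = 0 := by
  rw [fixedProj, Module.Basis.constr_basis, dif_neg hw]

theorem fixedProj_act (d : PGroupAction p S P φ G)
    {b : Module.Basis W ℤ[Γ] (Hecke S φ)} (hb : ∀ σ w, d.act σ (b w) = b (σ • w)) (σ : G)
    (x : Hecke S φ) : fixedProj b b' (d.act σ x) = fixedProj b b' x := by
  have h1 : (fixedProj b b').comp (d.act σ).toLinearMap = fixedProj b b' := by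
    refine b.ext fun v => ?_
    rw [LinearMap.comp_apply, AlgHom.toLinearMap_apply, hb]
    by_cases hv : v ∈ FixedPoints.subgroup G W
    · rw [hv σ]
    · rw [fixedProj_basis_of_notMem _ _ hv, fixedProj_basis_of_notMem _ _ fun h2 => hv fun τ => ?_]
      have h3 := h2 (σ * τ * σ⁻¹)
      rw [mul_smul, mul_smul, inv_smul_smul] at h3
      exact smul_left_cancel _ h3
  exact congrArg (fun F : Hecke S φ →ₗ[ℤ[Γ]] _ => F x) h1

theorem repr_fixedProj (x : Hecke S φ) (w : FixedPoints.subgroup G W) :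
    b'.repr (fixedProj b b' x) w = b.repr x w := by
  classical
  have h1 : (b'.coord w).comp (fixedProj b b') = b.coord (w : W) := by
    refine b.ext fun v => ?_
    rw [LinearMap.comp_apply, Module.Basis.coord_apply, Module.Basis.coord_apply,
      Module.Basis.repr_self_apply]
    by_cases hv : v ∈ FixedPoints.subgroup G W
    · obtain ⟨v, rfl⟩ : ∃ v' : FixedPoints.subgroup G W, (v' : W) = v := ⟨⟨v, hv⟩, rfl⟩
      rw [fixedProj_basis, Module.Basis.repr_self_apply]
      simp only [Subtype.coe_inj]
    · rw [fixedProj_basis_of_notMem _ _ hv, map_zero, Finsupp.zero_apply, if_neg]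
      rintro rfl
      exact hv w.2
  exact congrArg (fun F : Hecke S φ →ₗ[ℤ[Γ]] ℤ[Γ] => F x) h1

end Projection

/-- The projection onto the Hecke algebra of `W ^ G`, which kills `T_w` for `w ∉ W ^ G`. -/
def proj (d : PGroupAction p S P φ G) :
    Hecke S φ →ₗ[ℤ[Γ]] Hecke (fixedSimple S G) (fixedWeight φ G) :=
  fixedProj d.basis d.basisFixed

theorem proj_T (d : PGroupAction p S P φ G) (w : FixedPoints.subgroup G W) :
    d.proj (T S φ w) = T (fixedSimple S G) (fixedWeight φ G) w := by
  rw [proj, ← basisT_apply d.half d.weight, fixedProj_basis, basisT_apply]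

theorem proj_one (d : PGroupAction p S P φ G) : d.proj 1 = 1 := by
  have := d.proj_T 1
  rwa [Subgroup.coe_one, T_one, T_one] at this

theorem proj_act (d : PGroupAction p S P φ G) (σ : G) (x : Hecke S φ) :
    d.proj (d.act σ x) = d.proj x :=
  d.fixedProj_act _ d.act_basis σ x

theorem repr_proj (d : PGroupAction p S P φ G) (x : Hecke S φ) (w : FixedPoints.subgroup G W) :
    d.basisFixed.repr (d.proj x) w = d.basis.repr x w :=
  repr_fixedProj _ _ x w

theorem indexChar_act (d : PGroupAction p S P φ G) (σ : G) (x : Hecke S φ) :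
    indexChar d.weight (d.act σ x) = indexChar d.weight x := by
  have h1 : (indexChar d.weight).toLinearMap.comp (d.act σ).toLinearMap =
      (indexChar d.weight).toLinearMap := by
    refine d.basis.ext fun v => ?_
    simp only [LinearMap.comp_apply, basisT_apply, AlgHom.toLinearMap_apply, act_T, indexChar_T]
    exact congrArg expo (d.weight_map σ σ.2 v)
  exact congrArg (fun F : Hecke S φ →ₗ[ℤ[Γ]] ℤ[Γ] => F x) h1

theorem natCast_dvd_indexChar_sub (d : PGroupAction p S P φ G) {x : Hecke S φ}
    (hx : d.IsInvariant x) : (p : ℤ[Γ]) ∣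
      indexChar d.weight x - indexChar d.weight_fixed (d.proj x) := by
  rw [← Ideal.mem_span_singleton, ← Ideal.Quotient.eq]
  have hp : ((p : ℕ) : ℤ[Γ] ⧸ Ideal.span {(p : ℤ[Γ])}) = 0 := by
    rw [← map_natCast (Ideal.Quotient.mk _), Ideal.Quotient.eq_zero_iff_mem]
    exact Ideal.mem_span_singleton_self _
  refine d.eq_of_eq_on_fixed (M := ℤ[Γ] ⧸ Ideal.span {(p : ℤ[Γ])})
    (F := fun y => Ideal.Quotient.mk _ (indexChar d.weight y))
    (F' := fun y => Ideal.Quotient.mk _ (indexChar d.weight_fixed (d.proj y)))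
    (fun m => by rw [nsmul_eq_mul, hp, zero_mul])
    (fun y z => by simp only [map_add]) (fun y z => by simp only [map_add])
    (fun σ y => by simp only [indexChar_act]) (fun σ y => by simp only [proj_act]) hx
    fun w => congrArg (Ideal.Quotient.mk _) ?_
  rw [map_smul, map_smul, map_smul, proj_T, indexChar_T, indexChar_T]
  rfl

/-! ### The projection is multiplicative and commutes with bar modulo `p`. -/

section Reduction

variable {R : Type*} [Ring R]
  {q : Hecke (fixedSimple S G) (fixedWeight φ G) →+* R}

theorem map_smul_of_dvd (hq : (p : R) = 0) {a b : ℤ[Γ]} (hab : (p : ℤ[Γ]) ∣ a - b)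
    (x : Hecke (fixedSimple S G) (fixedWeight φ G)) : q (a • x) = q (b • x) := by
  obtain ⟨c, hc⟩ := hab
  rw [sub_eq_iff_eq_add.1 hc, add_smul, map_add, mul_smul, Nat.cast_smul_eq_nsmul, map_nsmul,
    nsmul_eq_mul, hq, zero_mul, zero_add]

theorem proj_T_mul_self (d : PGroupAction p S P φ G) (hq : (p : R) = 0)
    {x : FixedPoints.subgroup G W} (hx : x ∈ fixedSimple S G) :
    q (d.proj (T S φ x * T S φ x)) =
      q (T (fixedSimple S G) (fixedWeight φ G) x * T (fixedSimple S G) (fixedWeight φ G) x) := by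
  classical
  set k := T S φ (x : W) * T S φ (x : W) with hk
  have hxx : x * x = 1 := d.half_fixed.mul_self x hx
  have hx1 : x ≠ 1 := by
    rintro rfl
    have := d.half_fixed.wordLength_simple hx
    rw [wordLength_one] at this
    exact zero_ne_one this
  have h1 : d.basis.repr k 1 = 1 := by
    rw [hk, repr_T_mul_T_one, if_pos]
    exact congrArg Subtype.val hxx
  have h2 : d.proj k = 1 + d.basis.repr k x • T (fixedSimple S G) (fixedWeight φ G) x := by
    refine d.basisFixed.repr.injective (Finsupp.ext fun w => ?_)
    rw [repr_proj, map_add, map_smul, ← T_one, ← basisT_apply d.half_fixed d.weight_fixed,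
      ← basisT_apply d.half_fixed d.weight_fixed, Finsupp.add_apply, Finsupp.smul_apply,
      Module.Basis.repr_self_apply, Module.Basis.repr_self_apply]
    by_cases hw1 : w = 1
    · subst hw1
      simp [h1, hx1]
    by_cases hwx : w = x
    · subst hwx
      simp [hx1.symm]
    rw [if_neg (Ne.symm hw1), if_neg (Ne.symm hwx), smul_zero, add_zero]
    obtain ⟨s, hs, -, hl⟩ := hx
    refine repr_T_mul_T_of_notMem d.half d.weight (orbit_subset d.stable hs) hl.1 hl.1 ?_
    intro h3
    rcases eq_one_or_eq_of_mem_closure_orbit d.half d.stable hs hl w h3 with h4 | h4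
    · exact hw1 (Subtype.ext h4)
    · exact hwx (Subtype.ext h4)
  -- The index character gives `e^(2φ(x)) ≡ 1 + a e^φ(x)`, where `a` is the coefficient of `T_x` in
  -- `k`; multiplying by `e^(-φ(x))` isolates `a`.
  have h3 : (p : ℤ[Γ]) ∣ d.basis.repr k x - xi (fixedWeight φ G) x := by
    have h4 := d.natCast_dvd_indexChar_sub ((d.isInvariant_T x).mul (d.isInvariant_T x))
    rw [← hk, h2, map_add, map_one, map_smul, indexChar_T, hk, map_mul, indexChar_T] at h4
    have h5 := (dvd_neg.2 h4).mul_right (expo (-φ (x : W)))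
    have h6 := expo_mul_neg (φ (x : W))
    have h7 : fixedWeight φ G x = φ x := rfl
    rw [← hk, h7, smul_eq_mul] at h5
    rw [xi, h7]
    convert h5 using 1
    linear_combination (-d.basis.repr k x + expo (φ (x : W))) * h6
  rw [h2, T_mul_self hx, map_add, map_add, map_smul_of_dvd hq h3]

/-- When `x` shortens `v = x * u`, write the product as `T_x T_x T_u`. The square is supported on
`W_ω`, where `T_c T_u = T_{cu}`, and modulo `p` only `c = 1` and `c = x` survive. -/
theorem proj_T_mul_T_simple (d : PGroupAction p S P φ G) (hq : (p : R) = 0)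
    {x : FixedPoints.subgroup G W} (hx : x ∈ fixedSimple S G) (v : FixedPoints.subgroup G W) :
    q (d.proj (T S φ x * T S φ v)) =
      q (T (fixedSimple S G) (fixedWeight φ G) x * T (fixedSimple S G) (fixedWeight φ G) v) := by
  have hp : ∀ r : R, p • r = 0 := fun r => by rw [nsmul_eq_mul, hq, zero_mul]
  have hxx : x * x = 1 := d.half_fixed.mul_self x hx
  have hG : ∀ u : FixedPoints.subgroup G W, wordLength S (u : W) < wordLength S (x * u : W) →
      T (fixedSimple S G) (fixedWeight φ G) x * T (fixedSimple S G) (fixedWeight φ G) u =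
        T (fixedSimple S G) (fixedWeight φ G) (x * u) := by
    intro u hu
    refine T_simple_mul_of_lt d.half_fixed hx ?_
    have := (d.half_fixed.iff_lt hx).1 hu
    have := d.half_fixed.wordLength_simple_mul hx u
    lia
  obtain ⟨s, hs, -, hl⟩ := id hx
  have h0 := wordLength_isLongest_pos d.half d.stable hs hl
  rcases wordLength_fixedSimple_mul d.half d.stable hs hl v with ⟨-, h1⟩ | ⟨-, h1⟩
  · obtain ⟨u, rfl⟩ : ∃ u, v = x * u := ⟨x * v, by rw [← mul_assoc, hxx, one_mul]⟩
    have h2 : (x : W) * ((x * u : FixedPoints.subgroup G W) : W) = u := by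
      rw [← Subgroup.coe_mul, ← mul_assoc, hxx, one_mul]
    rw [h2, Subgroup.coe_mul] at h1
    have h3 : ∀ t ∈ MulAction.orbit G s, wordLength S (u : W) < wordLength S (t * u) := by
      rcases wordLength_fixedSimple_mul d.half d.stable hs hl u with ⟨-, h4⟩ | ⟨h4, -⟩
      · lia
      · exact h4
    have h4 : ∀ c ∈ Subgroup.closure (MulAction.orbit G s),
        T S φ c * T S φ u = T S φ (c * u) := fun c hc =>
      T_mul _ _ (d.half.wordLength_mul_of_ascents (orbit_subset d.stable hs) h3 hc)
    rw [Subgroup.coe_mul, ← h4 x hl.1, ← mul_assoc, ← hG u (by lia), ← mul_assoc, map_mul q,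
      ← d.proj_T_mul_self hq hx, ← map_mul]
    refine d.eq_of_eq_on_fixed hp (F := fun y => q (d.proj (y * T S φ u)))
      (F' := fun y => q (d.proj y * T (fixedSimple S G) (fixedWeight φ G) u))
      (fun y z => by simp only [add_mul, map_add]) (fun y z => by simp only [add_mul, map_add])
      (fun σ y => ?_) (fun σ y => by simp only [proj_act])
      ((d.isInvariant_T x).mul (d.isInvariant_T x)) fun w => ?_
    · rw [← d.proj_act σ (y * T S φ u), map_mul (d.act σ), d.isInvariant_T u σ]
    · by_cases hw : (w : W) ∈ Subgroup.closure (MulAction.orbit G s)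
      · rw [smul_mul_assoc, map_smul d.proj, map_smul d.proj, smul_mul_assoc, h4 w hw, ← Subgroup.coe_mul,
          proj_T, proj_T]
        rcases eq_one_or_eq_of_mem_closure_orbit d.half d.stable hs hl w hw with h5 | h5
        · have h5 : w = 1 := Subtype.ext h5
          rw [h5, T_one, one_mul, one_mul]
        · have h5 : w = x := Subtype.ext h5
          rw [h5, hG u (by lia)]
      · rw [repr_T_mul_T_of_notMem d.half d.weight (orbit_subset d.stable hs) hl.1 hl.1 hw]
        simp
  · rw [hG v (by lia), T_mul _ _ h1, ← Subgroup.coe_mul, proj_T]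

theorem proj_T_mul (d : PGroupAction p S P φ G) (hq : (p : R) = 0)
    (x : FixedPoints.subgroup G W) : ∀ y : Hecke S φ, d.IsInvariant y →
    q (d.proj (T S φ x * y)) = q (T (fixedSimple S G) (fixedWeight φ G) x * d.proj y) := by
  have hp : ∀ r : R, p • r = 0 := fun r => by rw [nsmul_eq_mul, hq, zero_mul]
  have simple : ∀ x ∈ fixedSimple S G, ∀ y : Hecke S φ, d.IsInvariant y →
      q (d.proj (T S φ x * y)) = q (T (fixedSimple S G) (fixedWeight φ G) x * d.proj y) := by
    intro x hx y hy
    refine d.eq_of_eq_on_fixed hp (F := fun y => q (d.proj (T S φ x * y)))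
      (F' := fun y => q (T (fixedSimple S G) (fixedWeight φ G) x * d.proj y))
      (fun y z => by simp only [mul_add, map_add]) (fun y z => by simp only [mul_add, map_add])
      (fun σ y => ?_) (fun σ y => by simp only [proj_act]) hy fun w => ?_
    · rw [← d.proj_act σ (T S φ x * y), map_mul (d.act σ), d.isInvariant_T x σ]
    · rw [mul_smul_comm, map_smul d.proj, map_smul d.proj, mul_smul_comm, Algebra.smul_def, map_mul,
        d.proj_T_mul_T_simple hq hx, proj_T, ← map_mul, ← Algebra.smul_def]
  induction x using d.half_fixed.induction with
  | one => intro y _; rw [Subgroup.coe_one, T_one, T_one, one_mul, one_mul]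
  | mul x hx c h1 ih =>
    intro y hy
    have h2 := d.half_fixed.wordLength_simple hx
    have h3 := d.wordLength_mul x c (by lia)
    rw [Subgroup.coe_mul, ← T_mul _ _ h3, mul_assoc,
      simple x hx _ ((d.isInvariant_T c).mul hy), map_mul, ih y hy, ← map_mul, ← mul_assoc,
      T_simple_mul_of_lt d.half_fixed hx h1]

theorem proj_mul (d : PGroupAction p S P φ G) (hq : (p : R) = 0) {x y : Hecke S φ}
    (hx : d.IsInvariant x) (hy : d.IsInvariant y) :
    q (d.proj (x * y)) = q (d.proj x * d.proj y) := by
  refine d.eq_of_eq_on_fixed (fun r => by rw [nsmul_eq_mul, hq, zero_mul])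
    (F := fun z => q (d.proj (z * y))) (F' := fun z => q (d.proj z * d.proj y))
    (fun y z => by simp only [add_mul, map_add]) (fun y z => by simp only [add_mul, map_add])
    (fun σ z => ?_) (fun σ z => by simp only [proj_act]) hx fun w => ?_
  · rw [← d.proj_act σ (z * y), map_mul (d.act σ), hy σ]
  · rw [smul_mul_assoc, map_smul d.proj, map_smul d.proj, smul_mul_assoc, Algebra.smul_def, map_mul,
      d.proj_T_mul hq w y hy, proj_T, ← map_mul, ← Algebra.smul_def]

/-- By multiplicativity, the projected bar of `T_w` is still inverse to the image of `T^G_{w⁻¹}`,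
and inverses are unique. -/
theorem proj_bar (d : PGroupAction p S P φ G) (hq : (p : R) = 0)
    {x : Hecke S φ} (hx : d.IsInvariant x) :
    q (d.proj (bar S φ x)) = q (bar (fixedSimple S G) (fixedWeight φ G) (d.proj x)) := by
  refine d.eq_of_eq_on_fixed (fun r => by rw [nsmul_eq_mul, hq, zero_mul])
    (F := fun z => q (d.proj (bar S φ z)))
    (F' := fun z => q (bar (fixedSimple S G) (fixedWeight φ G) (d.proj z)))
    (fun y z => by simp only [map_add]) (fun y z => by simp only [map_add])
    (fun σ z => ?_) (fun σ z => by simp only [proj_act]) hx fun w => ?_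
  · rw [← act_bar, proj_act]
  · have h1 : q (d.proj (bar S φ (T S φ w))) =
        q (bar (fixedSimple S G) (fixedWeight φ G) (T (fixedSimple S G) (fixedWeight φ G) w)) := by
      have h2 := d.proj_mul (q := q) hq (d.isInvariant_T w).bar (d.isInvariant_T w⁻¹)
      rw [Subgroup.coe_inv, ((isBar_bar d.half).2 (w : W)).1, proj_one, map_one,
        ← Subgroup.coe_inv, proj_T, map_mul] at h2
      have h3 := congrArg q ((isBar_bar (φ := fixedWeight φ G) d.half_fixed).2 w).2
      rw [map_mul, map_one] at h3
      exact left_inv_eq_right_inv h2.symm h3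
    rw [bar_smul d.half, map_smul d.proj, map_smul d.proj, bar_smul d.half_fixed, Algebra.smul_def, map_mul,
      h1, proj_T, ← map_mul, ← Algebra.smul_def]

end Reduction

end PGroupAction

end

end KL

namespace KL

noncomputable section

variable {W : Type*} [Group W] {Γ : Type*} [AddCommGroup Γ]
  {S : Set W} {φ : W → Γ} {P : W → W → Prop}

/-- Reduction of the Hecke algebra modulo `p`. -/
theorem exists_reduction.{u} {H : Type u} [Ring H] [Algebra ℤ[Γ] H] (p : ℕ) :
    ∃ (R : Type u) (_ : Ring R) (q : H →+* R), (p : R) = 0 ∧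
      ∀ x, q x = 0 → ∃ y, x = (p : ℤ[Γ]) • y := by
  have h2 : (Ideal.span {(p : H)}).IsTwoSided := ⟨fun b ha => by
    obtain ⟨c, rfl⟩ := Ideal.mem_span_singleton'.1 ha
    rw [mul_assoc, (Nat.cast_commute p b).eq, ← mul_assoc]
    exact Ideal.mul_mem_left _ _ (Ideal.mem_span_singleton_self _)⟩
  refine ⟨H ⧸ Ideal.span {(p : H)}, inferInstance, Ideal.Quotient.mk _, ?_, fun x hx => ?_⟩
  · rw [← map_natCast (Ideal.Quotient.mk (Ideal.span {(p : H)})), Ideal.Quotient.eq_zero_iff_mem]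
    exact Ideal.mem_span_singleton_self _
  · rw [Ideal.Quotient.eq_zero_iff_mem] at hx
    obtain ⟨c, rfl⟩ := Ideal.mem_span_singleton'.1 hx
    exact ⟨c, by rw [Nat.cast_smul_eq_nsmul, nsmul_eq_mul, (Nat.cast_commute p c).eq]⟩

/-! ### Comparison of the Kazhdan–Lusztig elements, structure constants and traces. -/

namespace PGroupAction

variable {p : ℕ} {G : Subgroup (MulAut W)} [LinearOrder Γ]

theorem act_mem_negPart (d : PGroupAction p S P φ G) (σ : G) {x : Hecke S φ}
    (hx : x ∈ negPart S φ) : d.act σ x ∈ negPart S φ := by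
  induction hx using AddSubgroup.closure_induction with
  | mem x hx =>
    obtain ⟨γ, hγ, w, rfl⟩ := hx
    exact AddSubgroup.subset_closure ⟨γ, hγ, σ • w, by rw [map_smul, act_T]⟩
  | zero => rw [map_zero]; exact zero_mem _
  | add x y _ _ hx hy => rw [map_add]; exact add_mem hx hy
  | neg x _ hx => rw [map_neg]; exact neg_mem hx

theorem proj_mem_negPart (d : PGroupAction p S P φ G) {x : Hecke S φ}
    (hx : x ∈ negPart S φ) : d.proj x ∈ negPart (fixedSimple S G) (fixedWeight φ G) :=
  mem_negPart_of_repr d.half_fixed d.weight_fixed fun w γ hγ => by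
    rw [repr_proj] at hγ
    exact neg_of_mem_negPart d.half d.weight hx w hγ

variable [IsOrderedAddMonoid Γ]

theorem act_C (d : PGroupAction p S P φ G) (σ : G) (w : W) :
    d.act σ (C S φ w) = C S φ (σ • w) := by
  have h1 := isKLElement_C d.half d.weight w
  refine IsKLElement.eq d.half d.weight ⟨?_, ?_⟩ (isKLElement_C d.half d.weight (σ • w))
  · rw [← act_bar, h1.1]
  · rw [← d.act_T, ← map_sub]
    exact d.act_mem_negPart σ h1.2

theorem isInvariant_C (d : PGroupAction p S P φ G) (w : FixedPoints.subgroup G W) :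
    d.IsInvariant (C S φ w) := fun σ => by rw [act_C, w.2 σ]

/-- The difference is negative because the leading terms `T^G_z` cancel, and bar-invariant modulo
`p` by `proj_bar`. -/
theorem exists_proj_C_sub (d : PGroupAction p S P φ G) (z : FixedPoints.subgroup G W) :
    ∃ y, d.proj (C S φ z) - C (fixedSimple S G) (fixedWeight φ G) z = (p : ℤ[Γ]) • y := by
  obtain ⟨R, _, q, hq, hker⟩ := exists_reduction (Γ := Γ)
    (H := Hecke (fixedSimple S G) (fixedWeight φ G)) p
  have h1 := isKLElement_C d.half d.weight (z : W)
  have h2 := isKLElement_C d.half_fixed d.weight_fixed z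
  have h3 : d.proj (C S φ z) - C (fixedSimple S G) (fixedWeight φ G) z ∈
      negPart (fixedSimple S G) (fixedWeight φ G) := by
    have h := d.proj_mem_negPart h1.2
    rw [map_sub, d.proj_T] at h
    rw [← sub_sub_sub_cancel_right _ _ (T (fixedSimple S G) (fixedWeight φ G) z)]
    exact sub_mem h h2.2
  obtain ⟨k, hk⟩ := hker (bar (fixedSimple S G) (fixedWeight φ G)
      (d.proj (C S φ z) - C (fixedSimple S G) (fixedWeight φ G) z) -
    (d.proj (C S φ z) - C (fixedSimple S G) (fixedWeight φ G) z)) (by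
      have h4 := d.proj_bar (q := q) hq (d.isInvariant_C z)
      rw [h1.1] at h4
      rw [map_sub (bar _ _), h2.1, sub_sub_sub_cancel_right, map_sub, ← h4, sub_self])
  exact exists_nsmul_of_bar_sub d.half_fixed d.weight_fixed h3 hk

theorem natCast_dvd_structureConst_sub (d : PGroupAction p S P φ G)
    (x y z : FixedPoints.subgroup G W) : (p : ℤ[Γ]) ∣ structureConst S φ (x : W) y z -
      structureConst (fixedSimple S G) (fixedWeight φ G) x y z := by
  obtain ⟨R, _, q, hq, hker⟩ := exists_reduction (Γ := Γ)
    (H := Hecke (fixedSimple S G) (fixedWeight φ G)) p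
  set b := basisC d.half d.weight with hb
  set b' := basisC d.half_fixed d.weight_fixed with hb'
  have hact : ∀ (σ : G) (w : W), d.act σ (b w) = b (σ • w) := fun σ w => by
    rw [hb, basisC_apply, basisC_apply, act_C]
  have hC : ∀ z : FixedPoints.subgroup G W, q (d.proj (b z)) = q (b' z) := fun z => by
    obtain ⟨y, hy⟩ := d.exists_proj_C_sub z
    rw [hb, hb', basisC_apply, basisC_apply, ← sub_eq_zero, ← map_sub, hy,
      Nat.cast_smul_eq_nsmul, map_nsmul, nsmul_eq_mul, hq, zero_mul]
  set X := C S φ (x : W) * C S φ (y : W) with hX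
  have hXinv : d.IsInvariant X := (d.isInvariant_C x).mul (d.isInvariant_C y)
  have h1 : q (d.proj X) = q (C (fixedSimple S G) (fixedWeight φ G) x *
      C (fixedSimple S G) (fixedWeight φ G) y) := by
    have hx := hC x
    have hy := hC y
    rw [hb, hb', basisC_apply, basisC_apply] at hx hy
    rw [hX, d.proj_mul hq (d.isInvariant_C x) (d.isInvariant_C y), map_mul, hx, hy, map_mul]
  -- Modulo `p` the projections along the `T`-bases and along the `C`-bases agree on invariants. The
  -- latter reads off the coordinates `h_{x,y,z}` exactly.
  have h2 : q (d.proj X) = q (fixedProj b b' X) := by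
    refine d.eq_of_eq_on_fixed_basis hact (fun r => by rw [nsmul_eq_mul, hq, zero_mul])
      (F := fun z => q (d.proj z)) (F' := fun z => q (fixedProj b b' z))
      (fun y z => by simp only [map_add]) (fun y z => by simp only [map_add])
      (fun σ z => by simp only [proj_act]) (fun σ z => by simp only [d.fixedProj_act b' hact])
      hXinv fun w => ?_
    rw [map_smul d.proj, map_smul (fixedProj b b'), fixedProj_basis, Algebra.smul_def, map_mul,
      hC, ← map_mul, ← Algebra.smul_def]
  obtain ⟨k, hk⟩ := hker (fixedProj b b' X - C (fixedSimple S G) (fixedWeight φ G) x *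
    C (fixedSimple S G) (fixedWeight φ G) y) (by rw [map_sub, ← h2, h1, sub_self])
  have h3 := congrArg (fun v => b'.repr v z) hk
  simp only [map_sub, map_smul, Finsupp.sub_apply, Finsupp.smul_apply, smul_eq_mul,
    repr_fixedProj] at h3
  rw [structureConst_eq d.half d.weight, structureConst_eq d.half_fixed d.weight_fixed]
  exact ⟨_, h3⟩

theorem natCast_dvd_tau_sub (d : PGroupAction p S P φ G) (z : FixedPoints.subgroup G W) :
    (p : ℤ[Γ]) ∣ tau S φ (C S φ z) - tau (fixedSimple S G) (fixedWeight φ G)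
      (C (fixedSimple S G) (fixedWeight φ G) z) := by
  obtain ⟨y, hy⟩ := d.exists_proj_C_sub z
  have h1 := congrArg (fun v => d.basisFixed.repr v 1) hy
  simp only [map_sub, map_smul, Finsupp.sub_apply, Finsupp.smul_apply, smul_eq_mul,
    repr_proj] at h1
  rw [tau_eq d.half d.weight, tau_eq d.half_fixed d.weight_fixed]
  exact ⟨_, h1⟩

end PGroupAction

end

end KL

theorem mainTheorem4 {B W Γ : Type*} [Finite B] [Group W] {M : CoxeterMatrix B}
    (cs : CoxeterSystem M W) [AddCommGroup Γ] [LinearOrder Γ] [IsOrderedAddMonoid Γ]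
    (S : Set W) (hS : S = Set.range cs.simple)
    (φ : W → Γ) (hφ : KL.IsWeightFunction S φ)
    (p : ℕ) (hp : p.Prime) (G : Subgroup (MulAut W)) [Finite G] (hG : IsPGroup p G)
    (hGS : ∀ σ ∈ G, (fun w => σ w) '' S = S) (hGφ : ∀ σ ∈ G, ∀ w : W, φ (σ w) = φ w) :
    KL.WellDefined S φ ∧ KL.WellDefined (KL.fixedSimple S G) (KL.fixedWeight φ G) ∧
      (∀ x y z : FixedPoints.subgroup G W,
        KL.structureConst S φ (x : W) (y : W) (z : W) -
            KL.structureConst (KL.fixedSimple S G) (KL.fixedWeight φ G) x y z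
          ∈ Ideal.span {(p : AddMonoidAlgebra ℤ Γ)}) ∧
      ∀ z : FixedPoints.subgroup G W,
        KL.tau S φ (KL.C S φ (z : W)) -
            KL.tau (KL.fixedSimple S G) (KL.fixedWeight φ G)
              (KL.C (KL.fixedSimple S G) (KL.fixedWeight φ G) z)
          ∈ Ideal.span {(p : AddMonoidAlgebra ℤ Γ)} := by
  have h : KL.HalfSystem S fun s w => KL.signCocycle cs w⁻¹ s = 0 :=
    hS ▸ KL.halfSystem_range_simple cs
  have d : KL.PGroupAction p S (fun s w => KL.signCocycle cs w⁻¹ s = 0) φ G :=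
    ⟨h, hφ, hp, inferInstance, hG, hGS, hGφ⟩
  refine ⟨KL.wellDefined h hφ, KL.wellDefined d.half_fixed d.weight_fixed, fun x y z => ?_,
    fun z => ?_⟩
  · exact Ideal.mem_span_singleton.2 (d.natCast_dvd_structureConst_sub x y z)
  · exact Ideal.mem_span_singleton.2 (d.natCast_dvd_tau_sub z)
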